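/- Let $N\ge 1$, $\tau\ge 1$ be integers and $0<p\le 1$. An access point serves $N$ clients; time is divided into slots, and the slots $k\tau,\dots,(k+1)\tau-1$ form the $k$-th frame. At the beginning of each frame one packet is generated for each client; it is dropped at the end of the frame if it has not been delivered. In each slot the access point transmits one packet that is still undelivered in the current frame, or idles; a transmitted packet is delivered with probability $p$, independently over slots. A policy chooses the transmissions on the basis of the past transmissions and their outcomes and, possibly, of a random seed independent of the channel; it is non-idling if it transmits whenever an undelivered packet is left in the frame. For $q\in\mathbb R$ let $d_j(t)$ be $tq$ minus the number of packets delivered for client $j$ in the frames $0,\dots,t-1$, and let $\varphi(t)=\sqrt{2t\log\log t}$. The policy MWDF lists the clients at the beginning of each frame in decreasing order of $d_j(t)/p$ (ties broken arbitrarily) and serves them during the frame in that order, each one until its packet is delivered. Let $I=\frac1\tau E\big[(\tau-\sum_{i=1}^N\gamma_i)^+\big]$, where $\gamma_1,\dots,\gamma_N$ are independent geometric variables on $\{1,2,\dots\}$ with parameter $p$, and suppose that $$N\,\frac qp=\tau\,(1-I).$$ Then the standard deviation of $\sum_{j=1}^N\frac{d_j(t+1)-d_j(t)}{p}$ has the same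 value $\sigma_{p,\tau}$ for all $t\ge 0$ and all non-idling policies. MWDF policies exist, and every MWDF policy is non-idling and satisfies, almost surely, $$\limsup_{t\to\infty}\frac{d_j(t)}{p\,\varphi(t)}=\frac{\sigma_{p,\tau}}{N}\qquad\text{for every } j=1,\dots,N .$$ Moreover, let $\Pi$ be the class of the policies $\pi$ for which there are real constants $v_j^\pi,w_j^\pi$ such that, almost surely, for every $j$, $\limsup_t |d_j(t)|/(p\varphi(t))<\infty$, $\limsup_t d_j(t)/(p\varphi(t))=v_j^\pi$ and $\liminf_t d_j(t)/(p\varphi(t))=w_j^\pi$, and such that $\sum_j v_j^\pi=\sigma_{p,\tau}$ and $\sum_j w_j^\pi=-\sigma_{p,\tau}$. Then every MWDF policy belongs to $\Pi$ and attains the minimum $$\min_{\pi\in\Pi}\ \max_{j=1,\dots,N} v_j^\pi=\frac{\sigma_{p,\tau}}{N}.$$ -/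

import Mathlib

open MeasureTheory ProbabilityTheory Filter

namespace RealTimeScheduling

noncomputable section

/-- The law-of-the-iterated-logarithm scaling `φ(t) = √(2 t log log t)`. -/
def phi (t : ℕ) : ℝ := Real.sqrt (2 * t * Real.log (Real.log t))

/-- The expected proportion of idle time `I = (1/τ) E[(τ - ∑ γ_i)⁺]`, the `γ_i` (numbers of attempts
needed to deliver a packet) being `N` independent geometric variables on `{1, 2, …}`.
Mathlib's `geometricMeasure` counts the failures before the first success, so `γ_i = g i + 1`. -/
def idleFraction (N τ : ℕ) (p : unitInterval) : ℝ :=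
  (1 / (τ : ℝ)) * ∫ g : Fin N → ℕ, max ((τ : ℝ) - ∑ i, ((g i : ℝ) + 1)) 0
    ∂(Measure.pi fun _ : Fin N => geometricMeasure p)

/-- What happens in one slot: the client whose packet is transmitted (`none` if the access point
idles), and whether this packet is delivered. -/
abbrev SlotRecord (N : ℕ) : Type := Option (Fin N) × Bool

/-- The records of the slots so far, the most recent slot first. With frame length `τ`, the slots
`kτ, …, (k+1)τ - 1` form the `k`-th frame. -/
abbrev History (N : ℕ) : Type := List (SlotRecord N)

/-- The part of a history that precedes the current frame. -/
def frameStart {N : ℕ} (τ : ℕ) (h : History N) : History N := h.drop (h.length % τ)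

/-- The clients whose packet of the current frame has not been delivered yet. -/
def undelivered {N : ℕ} (τ : ℕ) (h : History N) : Finset (Fin N) :=
  Finset.univ.filter fun i => (some i, true) ∉ h.take (h.length % τ)

/-- For the history `h` at the beginning of frame `t = h.length / τ`, the debt owed to client `i`:
`t q` minus the number of packets delivered for client `i` in the frames `0, …, t - 1`. -/
def debt {N : ℕ} (τ : ℕ) (q : ℝ) (h : History N) (i : Fin N) : ℝ :=
  ((h.length / τ : ℕ) : ℝ) * q - (h.count (some i, true) : ℝ)

/-- A (possibly randomized) scheduling policy: in each slot, given the history and a random seed in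
`E`, it transmits a packet that is still undelivered in the current frame, or idles. -/
structure Policy (N τ : ℕ) (E : Type*) [MeasurableSpace E] where
  act : History N → E → Option (Fin N)
  measurableSet_act : ∀ h a, MeasurableSet {e | act h e = a}
  act_undelivered : ∀ h e i, act h e = some i → i ∈ undelivered τ h

namespace Policy

variable {N τ : ℕ} {E : Type*} [MeasurableSpace E]

/-- A policy is non-idling if it transmits whenever some packet of the frame is undelivered. -/
def NonIdling (π : Policy N τ E) : Prop :=
  ∀ h e, (undelivered τ h).Nonempty → π.act h e ≠ none

/-- The maximum weighted debt first policies: at the beginning of each frame the clients are listed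
in decreasing order of `d_i / p` (ties broken in any way), and during the frame they are
served in that order, each one until its packet is delivered. `order h e k` is the client in the
`k`-th place of the list that is made after the history `h`. -/
def IsMWDF (p q : ℝ) (π : Policy N τ E) : Prop :=
  ∃ order : History N → E → Equiv.Perm (Fin N), ∀ h e,
    Antitone (fun k => debt τ q (frameStart τ h) (order (frameStart τ h) e k) / p) ∧
    π.act h e =
      (List.ofFn (order (frameStart τ h) e)).find? fun i => decide (i ∈ undelivered τ h)

/-- The history before slot `n` under the policy with seed `e`, when `x m i` tells whether a
transmission to client `i` in slot `m` succeeds. -/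
def history (π : Policy N τ E) (e : E) (x : ℕ → Fin N → Bool) : ℕ → History N
  | 0 => []
  | n + 1 =>
    (π.act (π.history e x n) e, (π.act (π.history e x n) e).elim false (x n)) :: π.history e x n

variable {Ω : Type*}

/-- The debt `d_j(t)` of client `j` at the beginning of frame `t`, for the random seed `U` and the
channel states `X`. -/
def debtAt (π : Policy N τ E) (q : ℝ) (U : Ω → E) (X : ℕ → Ω → Fin N → Bool)
    (j : Fin N) (t : ℕ) (ω : Ω) : ℝ :=
  debt τ q (π.history (U ω) (fun n => X n ω) (t * τ)) j

/-- The scaled debt `d_j(t) / (p φ(t))`. -/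
def scaledDebt (π : Policy N τ E) (p q : ℝ) (U : Ω → E) (X : ℕ → Ω → Fin N → Bool)
    (j : Fin N) (t : ℕ) (ω : Ω) : ℝ :=
  1 / phi t * (π.debtAt q U X j t ω / p)

/-- The increment `∑_j (d_j(t+1) - d_j(t)) / p` in frame `t`. -/
def totalIncrement (π : Policy N τ E) (p q : ℝ) (U : Ω → E) (X : ℕ → Ω → Fin N → Bool)
    (t : ℕ) (ω : Ω) : ℝ :=
  ∑ j, (π.debtAt q U X j (t + 1) ω - π.debtAt q U X j t ω) / p

/-- The policy belongs to the class `Π` with constants `v_j` and `w_j`: almost surely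
`limsup |d_j(t)| / (p φ(t))` is finite, `limsup d_j(t) / (p φ(t)) = v_j` and
`liminf d_j(t) / (p φ(t)) = w_j`, where `∑ v_j = σ` and `∑ w_j = -σ`. The limits are taken in the
extended reals. -/
structure InClass [MeasurableSpace Ω] (P : Measure Ω) (π : Policy N τ E) (p q : ℝ) (U : Ω → E)
    (X : ℕ → Ω → Fin N → Bool) (σ : ℝ) (v w : Fin N → ℝ) : Prop where
  finite_limsup : ∀ j, ∀ᵐ ω ∂P,
    limsup (fun t => ((|π.scaledDebt p q U X j t ω| : ℝ) : EReal)) atTop < ⊤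
  limsup_eq : ∀ j, ∀ᵐ ω ∂P,
    limsup (fun t => ((π.scaledDebt p q U X j t ω : ℝ) : EReal)) atTop = ((v j : ℝ) : EReal)
  liminf_eq : ∀ j, ∀ᵐ ω ∂P,
    liminf (fun t => ((π.scaledDebt p q U X j t ω : ℝ) : EReal)) atTop = ((w j : ℝ) : EReal)
  sum_v : ∑ j, v j = σ
  sum_w : ∑ j, w j = -σ

/-- The costs `max_j v_j` of the policies of the class `Π`. -/
def costs [MeasurableSpace Ω] (P : Measure Ω) (N τ : ℕ) (p q : ℝ) (U : Ω → E)
    (X : ℕ → Ω → Fin N → Bool) (σ : ℝ) : Set ℝ :=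
  {c | ∃ (π : Policy N τ E) (v w : Fin N → ℝ), π.InClass P p q U X σ v w ∧ c = ⨆ j, v j}

end Policy

end

end RealTimeScheduling

/-!
Let `s` be the number of successes of `τ` independent transmissions. A non-idling policy delivers
`min N s` packets in a frame, whatever the order of service (a slot in which nothing is left to send
may be given a fictitious outcome), so under such a policy the increments of the scaled total debt
`∑ j, d_j / p` are independent copies of `(N q - min N s) / p`. Conditioning on the first slot shows
that `E[min N s] / p` is the expected busy time `E[min τ (γ₁ + ⋯ + γ_N)] = τ (1 - I)`, hence the
heavy-traffic condition says that the increments are centered, and the law of the iterated logarithm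
applies to the scaled total debt.

Under a maximum weighted debt first policy any two debts differ by at most one at the beginning of
every frame. Hence each debt is an `N`-th of the total debt up to a bounded error, and all of them
fluctuate between `-σ / N` and `σ / N` on the scale `p φ`. No policy of the class does better,
because the maximum of the `v_j` is at least their mean `σ / N`.

In the law of the iterated logarithm the upper half comes from a maximal inequality for the
exponential martingale along geometric blocks. For the lower half, the required lower bound
`exp (-y)` for the probability that a sum of `m` terms exceeds `s √(2 m y)` follows from the central
limit theorem: cut the sum into a number of blocks proportional to `y`, and ask each of them to be
large.
-/

namespace RealTimeScheduling

section ExtendedRealLimits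

variable {ι : Type*} {f : Filter ι}

lemma limsup_coe_eq_coe_iff [f.NeBot] {u : ι → ℝ} {c : ℝ} :
    limsup (fun i => (u i : EReal)) f = c ↔
      (∀ b > c, ∀ᶠ i in f, u i ≤ b) ∧ ∀ b < c, ∃ᶠ i in f, b ≤ u i := by
  rw [le_antisymm_iff, limsup_le_iff', le_limsup_iff', EReal.forall, EReal.forall]
  simpa using fun _ _ => ‹f.NeBot›

lemma limsup_add_of_tendsto_zero [f.NeBot] {u v : ι → EReal} (hv : Tendsto v f (nhds 0)) :
    limsup (u + v) f = limsup u f := by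
  refine le_antisymm ?_ ?_
  · simpa [hv.limsup_eq] using
      EReal.limsup_add_le (u := u) (v := v) (f := f) (by simp [hv.limsup_eq])
        (by simp [hv.limsup_eq])
  · simpa [hv.liminf_eq] using EReal.le_limsup_add (u := u) (v := v) (f := f)

lemma limsup_coe_add_of_tendsto_zero [f.NeBot] {u v : ι → ℝ} (hv : Tendsto v f (nhds 0)) :
    limsup (fun i => ((u i + v i : ℝ) : EReal)) f = limsup (fun i => (u i : EReal)) f :=
  limsup_add_of_tendsto_zero (u := fun i => (u i : EReal)) (EReal.tendsto_coe.2 hv)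

lemma liminf_coe_eq_neg_limsup_coe_neg (u : ι → ℝ) :
    liminf (fun i => (u i : EReal)) f = -limsup (fun i => ((-u i : ℝ) : EReal)) f := by
  rw [← EReal.liminf_neg]
  simp [Pi.neg_def]

lemma liminf_coe_add_of_tendsto_zero [f.NeBot] {u v : ι → ℝ} (hv : Tendsto v f (nhds 0)) :
    liminf (fun i => ((u i + v i : ℝ) : EReal)) f = liminf (fun i => (u i : EReal)) f := by
  rw [liminf_coe_eq_neg_limsup_coe_neg, liminf_coe_eq_neg_limsup_coe_neg]
  simp only [neg_add]
  rw [limsup_coe_add_of_tendsto_zero (by simpa using hv.neg)]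

lemma limsup_coe_abs (u : ι → ℝ) :
    limsup (fun i => ((|u i| : ℝ) : EReal)) f =
      max (limsup (fun i => (u i : EReal)) f) (limsup (fun i => ((-u i : ℝ) : EReal)) f) := by
  rw [← limsup_max]
  rfl

end ExtendedRealLimits

section LogLog

/-- The function `√(2 y log log y)` of a real variable, which interpolates `phi`. -/
noncomputable def lilScale (y : ℝ) : ℝ := √(2 * y * Real.log (Real.log y))

lemma lilScale_natCast (n : ℕ) : lilScale n = phi n := rfl

lemma lilScale_nonneg (y : ℝ) : 0 ≤ lilScale y := Real.sqrt_nonneg _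

lemma tendsto_log_log_atTop : Tendsto (fun y => Real.log (Real.log y)) atTop atTop :=
  Real.tendsto_log_atTop.comp Real.tendsto_log_atTop

lemma isLittleO_log_log_id : (fun y => Real.log (Real.log y)) =o[atTop] id :=
  (Real.isLittleO_log_id_atTop.comp_tendsto Real.tendsto_log_atTop).trans
    Real.isLittleO_log_id_atTop

lemma sq_lilScale_eventuallyEq :
    (fun y => lilScale y ^ 2) =ᶠ[atTop] fun y => 2 * y * Real.log (Real.log y) := by
  filter_upwards [eventually_ge_atTop 0, tendsto_log_log_atTop.eventually_ge_atTop 0] with y hy hL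
  exact Real.sq_sqrt (by positivity)

lemma lilScale_isLittleO_id : lilScale =o[atTop] id := by
  refine Asymptotics.IsLittleO.of_pow (n := 2) ?_ two_ne_zero
  refine Asymptotics.IsLittleO.congr' (f₁ := fun y => 2 * y * Real.log (Real.log y))
    (g₁ := fun y => y * y) ?_ sq_lilScale_eventuallyEq.symm (.of_eq (by ext; simp [sq]))
  exact ((Asymptotics.isBigO_refl _ _).const_mul_left 2).mul_isLittleO isLittleO_log_log_id

lemma monotoneOn_lilScale : MonotoneOn lilScale (Set.Ioi 1) := by
  intro y (hy : 1 < y) z (hz : 1 < z) hyz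
  have hlog : Real.log (Real.log y) ≤ Real.log (Real.log z) :=
    Real.log_le_log (Real.log_pos hy) (Real.log_le_log (by linarith) hyz)
  rcases le_total 0 (Real.log (Real.log y)) with h0 | h0
  · exact Real.sqrt_le_sqrt (by gcongr)
  · rw [lilScale, Real.sqrt_eq_zero_of_nonpos (mul_nonpos_of_nonneg_of_nonpos (by linarith) h0)]
    exact lilScale_nonneg z

lemma eventually_sqrt_le_lilScale : ∀ᶠ y in atTop, √y ≤ lilScale y := by
  filter_upwards [eventually_ge_atTop 0, tendsto_log_log_atTop.eventually_ge_atTop 1] with y hy hL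
  exact Real.sqrt_le_sqrt (by nlinarith)

lemma tendsto_lilScale_atTop : Tendsto lilScale atTop atTop :=
  tendsto_atTop_mono' _ eventually_sqrt_le_lilScale Real.tendsto_sqrt_atTop

lemma summable_exp_neg_mul_log_log_pow_iff {r : ℝ} (hr : 1 < r) {b : ℝ} :
    Summable (fun k : ℕ => Real.exp (-(b * Real.log (Real.log (r ^ k))))) ↔ 1 < b := by
  have hlog : 0 < Real.log r := Real.log_pos hr
  have heq : (fun k : ℕ => Real.exp (-(b * Real.log (Real.log (r ^ k))))) =ᶠ[atTop]
      fun k => (Real.log r ^ b)⁻¹ * ((k : ℝ) ^ b)⁻¹ := by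
    filter_upwards [eventually_gt_atTop 0] with k hk
    have hk : (0 : ℝ) < k := by exact_mod_cast hk
    rw [Real.log_pow, mul_comm b, Real.exp_neg, ← Real.rpow_def_of_pos (by positivity),
      Real.mul_rpow hk.le hlog.le, mul_inv, mul_comm]
  rw [summable_congr_atTop heq, summable_mul_left_iff (by positivity), Real.summable_nat_rpow_inv]

lemma eventually_le_mul_phi_of_blocks {S : ℕ → ℝ} {r s : ℝ} (hr : 1 < r) (hs : 0 ≤ s)
    (h : ∀ᶠ k : ℕ in atTop, ∀ n : ℕ, n ≤ r ^ (k + 1) → S n ≤ s * lilScale (r ^ k)) :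
    ∀ᶠ n in atTop, S n ≤ s * phi n := by
  obtain ⟨K, hK⟩ := eventually_atTop.1 h
  filter_upwards [eventually_ge_atTop ⌈r ^ (K + 1)⌉₊] with n hn
  have hrn : r ^ (K + 1) ≤ n := Nat.ceil_le.1 hn
  obtain ⟨k, hkn, hnk⟩ := exists_nat_pow_near ((one_lt_pow₀ hr K.succ_ne_zero).le.trans hrn) hr
  have hKk : K + 1 < k + 1 := (pow_lt_pow_iff_right₀ hr).1 (hrn.trans_lt hnk)
  have hrk : 1 < r ^ k := one_lt_pow₀ hr (by omega)
  calc S n ≤ s * lilScale (r ^ k) := hK k (by omega) n hnk.le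
    _ ≤ s * phi n := by
      rw [← lilScale_natCast]
      gcongr
      exact monotoneOn_lilScale hrk (hrk.trans_le hkn) hkn

end LogLog

lemma ae_eventually_notMem_of_summable_measureReal {Ω : Type*} [MeasurableSpace Ω] {P : Measure Ω}
    [IsFiniteMeasure P] {A : ℕ → Set Ω} (hA : Summable fun k => P.real (A k)) :
    ∀ᵐ ω ∂P, ∀ᶠ k in atTop, ω ∉ A k := by
  refine ae_eventually_notMem ?_
  simpa [Measure.real, ENNReal.ofReal_toReal] using hA.tsum_ofReal_ne_top

section MaximalInequality

variable {Ω : Type*} [MeasurableSpace Ω] {P : Measure Ω} [IsProbabilityMeasure P]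

lemma one_le_mgf_of_integral_eq_zero {Y : Ω → ℝ} {l : ℝ} (hY : Integrable Y P)
    (hexp : Integrable (fun ω => Real.exp (l * Y ω)) P) (h0 : ∫ ω, Y ω ∂P = 0) :
    1 ≤ mgf Y P l := by
  calc 1 = ∫ ω, (l * Y ω + 1) ∂P := by
        rw [integral_add (hY.const_mul l) (integrable_const _), integral_const_mul, h0]
        simp
    _ ≤ mgf Y P l := integral_mono ((hY.const_mul l).add (integrable_const _)) hexp
        fun ω => Real.add_one_le_exp (l * Y ω)

lemma eventually_mgf_le_exp {Y : Ω → ℝ} {w : ℝ} (hY : 0 ∈ interior (integrableExpSet Y P))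
    (h0 : ∫ ω, Y ω ∂P = 0) (hw : variance Y P < w) :
    ∀ᶠ l in nhdsWithin 0 (Set.Ioi 0), mgf Y P l ≤ Real.exp (w * l ^ 2 / 2) := by
  have hcgf : iteratedDeriv 2 (cgf Y P) 0 < w := by
    rw [variance_of_integral_eq_zero (aemeasurable_of_mem_interior_integrableExpSet hY) h0] at hw
    simpa [iteratedDeriv_two_cgf_eq_integral hY, deriv_cgf_zero hY, h0] using hw
  have hcont : ContinuousAt (iteratedDeriv 2 (cgf Y P)) 0 := by
    rw [iteratedDeriv_eq_iterate]
    exact (analyticOnNhd_cgf.iterated_deriv 2 0 hY).continuousAt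
  have hnear : ∀ᶠ u in nhds 0, u ∈ interior (integrableExpSet Y P) ∧
      iteratedDeriv 2 (cgf Y P) u < w :=
    (isOpen_interior.eventually_mem hY).and (hcont.eventually_lt_const hcgf)
  obtain ⟨δ, hδ, hball⟩ := Metric.eventually_nhds_iff_ball.1 hnear
  filter_upwards [Ioo_mem_nhdsGT hδ] with l ⟨hl0, hlδ⟩
  have hIcc : ∀ u ∈ Set.Icc 0 l, u ∈ Metric.ball (0 : ℝ) δ := fun u hu => by
    rw [mem_ball_zero_iff, Real.norm_of_nonneg hu.1]
    exact hu.2.trans_lt hlδ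
  obtain ⟨u, hu, hul⟩ := exists_cgf_eq_iteratedDeriv_two_cgf_mul hl0 h0
    fun u hu => (hball u (hIcc u hu)).1
  have hl : l ∈ integrableExpSet Y P :=
    interior_subset (hball l (hIcc l (Set.right_mem_Icc.2 hl0.le))).1
  rw [← exp_cgf hl, hul]
  have := (hball u (hIcc u (Set.Ioo_subset_Icc_self hu))).2.le
  gcongr

variable {Z : ℕ → Ω → ℝ}

lemma submartingale_exp_mul_sum {l : ℝ} (hm : ∀ n, StronglyMeasurable (Z n)) (hi : iIndepFun Z P)
    (hexp : ∀ n, Integrable (fun ω => Real.exp (l * Z n ω)) P) (hmgf : ∀ n, 1 ≤ mgf (Z n) P l) :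
    Submartingale (fun n ω => Real.exp (l * ∑ i ∈ Finset.range (n + 1), Z i ω))
      (Filtration.natural Z hm) P := by
  have hadapted : StronglyAdapted (Filtration.natural Z hm)
      fun n ω => Real.exp (l * ∑ i ∈ Finset.range (n + 1), Z i ω) := fun n => by
    refine Real.continuous_exp.comp_stronglyMeasurable (.const_mul ?_ l)
    refine Finset.stronglyMeasurable_fun_sum _ fun i hin => ?_
    exact (Filtration.stronglyAdapted_natural hm i).mono
      ((Filtration.natural Z hm).mono (Finset.mem_range_succ_iff.1 hin))
  have hint : ∀ n, Integrable (fun ω => Real.exp (l * ∑ i ∈ Finset.range (n + 1), Z i ω)) P :=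
    fun n => by
      simpa using hi.integrable_exp_mul_sum (fun i => (hm i).measurable) (fun i _ => hexp i)
  refine submartingale_nat hadapted hint fun n => ?_
  have hsplit : (fun ω => Real.exp (l * ∑ i ∈ Finset.range (n + 1 + 1), Z i ω)) =
      (fun ω => Real.exp (l * ∑ i ∈ Finset.range (n + 1), Z i ω)) *
        fun ω => Real.exp (l * Z (n + 1) ω) := by
    ext ω
    simp [Finset.sum_range_succ _ (n + 1), mul_add, Real.exp_add]
  have hmul := condExp_mul_of_stronglyMeasurable_left (hadapted n) (hsplit ▸ hint (n + 1))
    (hexp (n + 1))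
  have hindep : P[fun ω => Real.exp (l * Z (n + 1) ω) | Filtration.natural Z hm n] =ᵐ[P]
      fun _ => mgf (Z (n + 1)) P l :=
    condExp_indep_eq (hm (n + 1)).measurable.comap_le (Filtration.le _ n)
      (Real.continuous_exp.comp_stronglyMeasurable
        ((comap_measurable (Z (n + 1))).stronglyMeasurable.const_mul l))
      (hi.indep_comap_natural_of_lt hm n.lt_succ_self)
  rw [hsplit]
  filter_upwards [hmul, hindep] with ω hω hω'
  rw [hω, Pi.mul_apply, hω']
  exact le_mul_of_one_le_right (Real.exp_pos _).le (hmgf (n + 1))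

lemma measureReal_exists_le_sum_le {l : ℝ} (hl : 0 ≤ l) (hm : ∀ n, Measurable (Z n))
    (hi : iIndepFun Z P) (hd : ∀ n, IdentDistrib (Z n) (Z 0) P P)
    (hexp : Integrable (fun ω => Real.exp (l * Z 0 ω)) P) (hmgf : 1 ≤ mgf (Z 0) P l)
    (x : ℝ) (n : ℕ) :
    P.real {ω | ∃ k ≤ n, x ≤ ∑ i ∈ Finset.range (k + 1), Z i ω} ≤
      Real.exp (-(l * x)) * mgf (Z 0) P l ^ (n + 1) := by
  have hsub := submartingale_exp_mul_sum (l := l) (fun n => (hm n).stronglyMeasurable) hi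
    (fun n => ((hd n).comp (u := fun z => Real.exp (l * z)) (by fun_prop)).integrable_iff.2 hexp)
    (fun n => mgf_congr_of_identDistrib _ _ (hd n) l ▸ hmgf)
  have hmax := maximal_ineq hsub (fun _ _ => (Real.exp_pos _).le)
    (ε := ⟨Real.exp (l * x), (Real.exp_pos _).le⟩) n
  set A := {ω | Real.exp (l * x) ≤ (Finset.range (n + 1)).sup' Finset.nonempty_range_add_one
    fun k => Real.exp (l * ∑ i ∈ Finset.range (k + 1), Z i ω)} with hA
  have hsubset : {ω | ∃ k ≤ n, x ≤ ∑ i ∈ Finset.range (k + 1), Z i ω} ⊆ A := by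
    rintro ω ⟨k, hk, hx⟩
    rw [hA, Set.mem_ofPred_eq, Finset.le_sup'_iff]
    exact ⟨k, Finset.mem_range_succ_iff.2 hk, by gcongr⟩
  have hsum : ∫ ω, Real.exp (l * ∑ i ∈ Finset.range (n + 1), Z i ω) ∂P =
      mgf (Z 0) P l ^ (n + 1) := by
    simpa [mgf] using mgf_sum_of_identDistrib (s := Finset.range (n + 1)) hm hi
      (fun i _ j _ => (hd i).trans (hd j).symm) (Finset.mem_range.2 n.succ_pos) l
  have hmarkov : Real.exp (l * x) * P.real A ≤ mgf (Z 0) P l ^ (n + 1) := by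
    have hA_le : ENNReal.ofReal (Real.exp (l * x)) * P A ≤
        ENNReal.ofReal (mgf (Z 0) P l ^ (n + 1)) := by
      rw [ENNReal.ofReal_eq_coe_nnreal (Real.exp_pos _).le]
      refine hmax.trans (ENNReal.ofReal_le_ofReal ?_)
      rw [← hsum]
      exact setIntegral_le_integral (hsub.integrable n) (.of_forall fun _ => (Real.exp_pos _).le)
    have := ENNReal.toReal_mono ENNReal.ofReal_ne_top hA_le
    rwa [ENNReal.toReal_mul, ENNReal.toReal_ofReal (Real.exp_pos _).le,
      ENNReal.toReal_ofReal (pow_nonneg mgf_nonneg _)] at this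
  rw [Real.exp_neg, ← div_eq_inv_mul, le_div_iff₀' (Real.exp_pos _)]
  exact (mul_le_mul_of_nonneg_left (measureReal_mono hsubset) (Real.exp_pos _).le).trans hmarkov

end MaximalInequality

section UpperHalf

variable {Ω : Type*} [MeasurableSpace Ω] {P : Measure Ω} [IsProbabilityMeasure P]
  {Z : ℕ → Ω → ℝ}

lemma exists_measureReal_exists_le_sum_le_exp {w : ℝ} (hm : ∀ n, Measurable (Z n))
    (hi : iIndepFun Z P) (hd : ∀ n, IdentDistrib (Z n) (Z 0) P P)
    (hZ : 0 ∈ interior (integrableExpSet (Z 0) P)) (h0 : ∫ ω, Z 0 ω ∂P = 0)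
    (hw : variance (Z 0) P < w) :
    ∃ δ > 0, ∀ (x y : ℝ) (n : ℕ), 0 < x → x ≤ δ * y → n + 1 ≤ y →
      P.real {ω | ∃ k ≤ n, x ≤ ∑ i ∈ Finset.range (k + 1), Z i ω} ≤
        Real.exp (-(x ^ 2 / (2 * w * y))) := by
  have hw0 : 0 < w := (variance_nonneg _ _).trans_lt hw
  have hnear : ∀ᶠ l in nhdsWithin 0 (Set.Ioi 0), l ∈ integrableExpSet (Z 0) P ∧
      mgf (Z 0) P l ≤ Real.exp (w * l ^ 2 / 2) :=
    (eventually_nhdsWithin_of_eventually_nhds (mem_interior_iff_mem_nhds.1 hZ)).and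
      (eventually_mgf_le_exp hZ h0 hw)
  obtain ⟨l₀, hl₀, hl₀'⟩ := mem_nhdsGT_iff_exists_Ioc_subset.1 hnear
  refine ⟨w * l₀, mul_pos hw0 hl₀, fun x y n hx hxy hny => ?_⟩
  have hy : 0 < y := (Nat.cast_add_one_pos n).trans_le hny
  set l := x / (w * y) with hl_def
  have hl : 0 < l := by positivity
  obtain ⟨hexp, hmgf⟩ := hl₀' ⟨hl, (div_le_iff₀ (by positivity)).2 (by linarith)⟩
  calc P.real {ω | ∃ k ≤ n, x ≤ ∑ i ∈ Finset.range (k + 1), Z i ω}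
      ≤ Real.exp (-(l * x)) * mgf (Z 0) P l ^ (n + 1) :=
        measureReal_exists_le_sum_le hl.le hm hi hd hexp
          (one_le_mgf_of_integral_eq_zero (integrable_of_mem_interior_integrableExpSet hZ) hexp h0)
          x n
    _ ≤ Real.exp (-(l * x)) * Real.exp (w * l ^ 2 / 2) ^ (n + 1) := by
        gcongr
        exact mgf_nonneg
    _ = Real.exp (-(l * x) + (n + 1) * (w * l ^ 2 / 2)) := by
        rw [← Real.exp_nat_mul, Real.exp_add, Nat.cast_succ]
    _ ≤ Real.exp (-(l * x) + y * (w * l ^ 2 / 2)) := by gcongr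
    _ = Real.exp (-(x ^ 2 / (2 * w * y))) := by
        rw [hl_def]
        field_simp
        ring_nf

theorem ae_eventually_sum_le_mul_phi {s : ℝ} (hs : 0 < s) (hm : ∀ n, Measurable (Z n))
    (hi : iIndepFun Z P) (hd : ∀ n, IdentDistrib (Z n) (Z 0) P P)
    (hZ : 0 ∈ interior (integrableExpSet (Z 0) P)) (h0 : ∫ ω, Z 0 ω ∂P = 0)
    (hvs : variance (Z 0) P < s ^ 2) :
    ∀ᵐ ω ∂P, ∀ᶠ n in atTop, ∑ i ∈ Finset.range n, Z i ω ≤ s * phi n := by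
  obtain ⟨w, hvw, hws⟩ := exists_between hvs
  have hw : 0 < w := (variance_nonneg _ _).trans_lt hvw
  obtain ⟨r, hr, hrs⟩ := exists_between ((one_lt_div hw).2 hws)
  have : 0 < r := one_pos.trans hr
  have hrw : 1 < s ^ 2 / (w * r) := by
    rw [one_lt_div (by positivity), mul_comm]
    exact (lt_div_iff₀ hw).1 hrs
  obtain ⟨δ, hδ, htail⟩ := exists_measureReal_exists_le_sum_le_exp hm hi hd hZ h0 hvw
  have hpow : Tendsto (fun k : ℕ => r ^ k) atTop atTop := tendsto_pow_atTop_atTop_of_one_lt hr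
  have hsmall : ∀ᶠ k : ℕ in atTop, s * lilScale (r ^ k) ≤ δ * r ^ (k + 1) := by
    filter_upwards [hpow.eventually (lilScale_isLittleO_id.bound (div_pos hδ hs))] with k hk
    rw [Real.norm_of_nonneg (lilScale_nonneg _), id, Real.norm_of_nonneg (by positivity),
      div_mul_eq_mul_div, le_div_iff₀' hs] at hk
    exact hk.trans (by gcongr <;> [exact hr.le; omega])
  have hbound : ∀ᶠ k : ℕ in atTop, P.real {ω | ∃ j ≤ ⌊r ^ (k + 1)⌋₊ - 1,
      s * lilScale (r ^ k) ≤ ∑ i ∈ Finset.range (j + 1), Z i ω} ≤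
        Real.exp (-(s ^ 2 / (w * r) * Real.log (Real.log (r ^ k)))) := by
    filter_upwards [hsmall, hpow.eventually sq_lilScale_eventuallyEq,
      hpow.eventually (tendsto_lilScale_atTop.eventually_gt_atTop 0)] with k hk hsq hpos
    have hfloor : 1 ≤ ⌊r ^ (k + 1)⌋₊ := (Nat.one_le_floor_iff _).2 (one_le_pow₀ hr.le)
    refine (htail _ _ _ (mul_pos hs hpos) hk ?_).trans_eq ?_
    · rw [← Nat.cast_succ, Nat.succ_eq_add_one, Nat.sub_add_cancel hfloor]
      exact Nat.floor_le (by positivity)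
    · rw [mul_pow, hsq, pow_succ r k]
      field_simp
  have hsum := ((summable_exp_neg_mul_log_log_pow_iff hr).2 hrw).of_norm_bounded_eventually_nat
    (hbound.mono fun k hk => by rwa [Real.norm_of_nonneg measureReal_nonneg])
  filter_upwards [ae_eventually_notMem_of_summable_measureReal hsum] with ω hω
  refine eventually_le_mul_phi_of_blocks hr hs.le ?_
  filter_upwards [hω] with k hk n hn
  rcases n with _ | n
  · simpa using mul_nonneg hs.le (lilScale_nonneg _)
  · have hnk : n ≤ ⌊r ^ (k + 1)⌋₊ - 1 := Nat.le_sub_one_of_lt (Nat.le_floor hn)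
    exact (not_le.1 fun h => hk ⟨n, hnk, h⟩).le

end UpperHalf

section BlockSums

variable {Ω : Type*} [MeasurableSpace Ω] {P : Measure Ω}

lemma iIndepFun_of_indep_of_measurable_succ [IsProbabilityMeasure P] {β : Type*}
    [MeasurableSpace β] {f : ℕ → Ω → β} {F : ℕ → MeasurableSpace Ω} (hF : Monotone F)
    (hf : ∀ n, Measurable[F (n + 1)] (f n))
    (hfF : ∀ n, Indep (MeasurableSpace.comap (f n) inferInstance) (F n) P) :
    iIndepFun f P := by
  rw [iIndepFun_iff]
  intro s
  induction s using Finset.induction_on_max with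
  | empty => simp
  | insert a s hs ih =>
    intro A hA
    have ha : a ∉ s := fun h => lt_irrefl _ (hs a h)
    rw [Finset.prod_insert ha, ← ih fun i hi => hA i (Finset.mem_insert_of_mem hi),
      Finset.set_biInter_insert]
    refine (Indep_iff _ _ _).1 (hfF a) _ _ (hA a (Finset.mem_insert_self _ _)) ?_
    refine MeasurableSet.biInter s.countable_toSet fun i hi => ?_
    obtain ⟨B, hB, hBA⟩ := hA i (Finset.mem_insert_of_mem hi)
    rw [← hBA]
    exact hF (Nat.succ_le_of_lt (hs i hi)) _ (hf i hB)

lemma measurable_iSup_comap {Ω ι : Type*} {β : ι → Type*} [∀ i, MeasurableSpace (β i)]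
    (f : ∀ i, Ω → β i) {S : Set ι} {i : ι} (hi : i ∈ S) :
    Measurable[⨆ k ∈ S, MeasurableSpace.comap (f k) inferInstance] (f i) :=
  (comap_measurable (f i)).mono
    (le_biSup (fun k => MeasurableSpace.comap (f k) inferInstance) hi) le_rfl

variable {Z : ℕ → Ω → ℝ}

lemma iIndepFun_sum_Ico (hm : ∀ n, Measurable (Z n)) (hi : iIndepFun Z P) {a b : ℕ → ℕ}
    (ha : Monotone a) (hab : ∀ j, b j ≤ a (j + 1)) :
    iIndepFun (fun j ω => ∑ i ∈ Finset.Ico (a j) (b j), Z i ω) P := by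
  have := hi.isProbabilityMeasure
  refine iIndepFun_of_indep_of_measurable_succ
    (F := fun j => ⨆ i ∈ Set.Iio (a j), MeasurableSpace.comap (Z i) inferInstance)
    (fun j k hjk => biSup_mono fun i hij => lt_of_lt_of_le hij (ha hjk)) (fun j => ?_) fun j => ?_
  · exact Finset.measurable_fun_sum
      (m := ⨆ i ∈ Set.Iio (a (j + 1)), MeasurableSpace.comap (Z i) inferInstance) _ fun i hij =>
      measurable_iSup_comap Z ((Finset.mem_Ico.1 hij).2.trans_le (hab j))
  · refine indep_of_indep_of_le_left (indep_iSup_of_disjoint (fun i => (hm i).comap_le) hi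
      (S := Set.Ici (a j)) (Set.Iio_disjoint_Ici le_rfl).symm) (Measurable.comap_le ?_)
    exact Finset.measurable_fun_sum
      (m := ⨆ i ∈ Set.Ici (a j), MeasurableSpace.comap (Z i) inferInstance) _ fun i hij =>
      measurable_iSup_comap Z (Finset.mem_Ico.1 hij).1

lemma identDistrib_sum_Ico (hi : iIndepFun Z P) (hd : ∀ n, IdentDistrib (Z n) (Z 0) P P)
    (m b : ℕ) :
    IdentDistrib (fun ω => ∑ i ∈ Finset.Ico m (m + b), Z i ω)
      (fun ω => ∑ i ∈ Finset.range b, Z i ω) P P := by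
  have hshift := IdentDistrib.pi (X := fun i => Z (m + i)) (Y := Z)
    (fun i => (hd (m + i)).trans (hd i).symm) (hi.precomp (add_right_injective m)) hi
  have := hshift.comp (u := fun z : ℕ → ℝ => ∑ i ∈ Finset.range b, z i)
    (Finset.measurable_fun_sum _ fun i _ => measurable_pi_apply i)
  simpa [Function.comp_def, Finset.sum_Ico_eq_sum_range] using this

lemma sum_range_mul {M : Type*} [AddCommMonoid M] (f : ℕ → M) (k b : ℕ) :
    ∑ i ∈ Finset.range (k * b), f i =
      ∑ j ∈ Finset.range k, ∑ i ∈ Finset.Ico (j * b) (j * b + b), f i := by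
  induction k with
  | zero => simp
  | succ k ih =>
    rw [Finset.sum_range_succ, ← ih, Nat.succ_mul,
      Finset.sum_range_add_sum_Ico _ (Nat.le_add_right (k * b) b)]

lemma measureReal_le_sum_pow_le (hm : ∀ n, Measurable (Z n)) (hi : iIndepFun Z P)
    (hd : ∀ n, IdentDistrib (Z n) (Z 0) P P) (x : ℝ) (b k : ℕ) :
    P.real {ω | x ≤ ∑ i ∈ Finset.range b, Z i ω} ^ k ≤
      P.real {ω | k * x ≤ ∑ i ∈ Finset.range (k * b), Z i ω} := by
  have := hi.isProbabilityMeasure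
  have hblock : iIndepFun (fun j ω => ∑ i ∈ Finset.Ico (j * b) (j * b + b), Z i ω) P :=
    iIndepFun_sum_Ico hm hi (fun i j hij => Nat.mul_le_mul_right b hij)
      fun j => (Nat.succ_mul j b).ge
  have hprod : P (⋂ j ∈ Finset.range k,
      {ω | x ≤ ∑ i ∈ Finset.Ico (j * b) (j * b + b), Z i ω}) =
      P {ω | x ≤ ∑ i ∈ Finset.range b, Z i ω} ^ k := by
    refine (hblock.meas_biInter fun j _ => ⟨Set.Ici x, measurableSet_Ici, rfl⟩).trans ?_
    rw [Finset.prod_congr rfl fun j _ =>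
        (identDistrib_sum_Ico hi hd (j * b) b).measure_mem_eq measurableSet_Ici,
      Finset.prod_const, Finset.card_range]
    rfl
  rw [measureReal_def, ← ENNReal.toReal_pow, ← hprod]
  refine measureReal_mono fun ω hω => ?_
  simp only [Finset.mem_range, Set.mem_iInter, Set.mem_ofPred_eq] at hω
  rw [Set.mem_ofPred_eq, sum_range_mul]
  simpa using Finset.card_nsmul_le_sum (Finset.range k) _ x (by simpa using hω)

end BlockSums

section GaussianLowerBound

lemma exp_div_three_le_gaussianPDFReal (x : ℝ) :
    Real.exp (-x ^ 2 / 2) / 3 ≤ gaussianPDFReal 0 1 x := by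
  have hsqrt : √(2 * Real.pi) ≤ 3 := by
    rw [Real.sqrt_le_left (by norm_num)]
    linarith [Real.pi_lt_four]
  have : 0 < √(2 * Real.pi) := Real.sqrt_pos.2 Real.two_pi_pos
  simp only [gaussianPDFReal, NNReal.coe_one, mul_one, sub_zero]
  rw [div_eq_inv_mul]
  gcongr

lemma exp_lt_measureReal_gaussianReal_Ioi {a : ℝ} (ha : 0 ≤ a) :
    Real.exp (-(a + 3) ^ 2 / 2) < (gaussianReal 0 1).real (Set.Ioi a) := by
  have hexp : 3 < Real.exp (2 * a + 4) := by linarith [Real.add_one_le_exp (2 * a + 4)]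
  have hshift : Real.exp (-(a + 1) ^ 2 / 2) =
      Real.exp (-(a + 3) ^ 2 / 2) * Real.exp (2 * a + 4) := by
    rw [← Real.exp_add]
    ring_nf
  calc Real.exp (-(a + 3) ^ 2 / 2)
      < Real.exp (-(a + 1) ^ 2 / 2) / 3 := by
        rw [hshift, mul_div_assoc]
        exact lt_mul_of_one_lt_right (Real.exp_pos _) ((one_lt_div (by norm_num)).2 hexp)
    _ = ∫ _ in Set.Ioc a (a + 1), Real.exp (-(a + 1) ^ 2 / 2) / 3 := by simp
    _ ≤ ∫ x in Set.Ioc a (a + 1), gaussianPDFReal 0 1 x := by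
        refine setIntegral_mono_on (by simp) (integrable_gaussianPDFReal 0 1).integrableOn
          measurableSet_Ioc fun x hx => le_trans ?_ (exp_div_three_le_gaussianPDFReal x)
        have := ha.trans hx.1.le
        gcongr
        exact hx.2
    _ = (gaussianReal 0 1).real (Set.Ioc a (a + 1)) := by
        rw [measureReal_def, gaussianReal_apply_eq_integral 0 one_ne_zero, ENNReal.toReal_ofReal
          (integral_nonneg fun x => gaussianPDFReal_nonneg 0 1 x)]
    _ ≤ (gaussianReal 0 1).real (Set.Ioi a) := measureReal_mono Set.Ioc_subset_Ioi_self

variable {Ω : Type*} [MeasurableSpace Ω] {P : Measure Ω} [IsProbabilityMeasure P]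
  {Z : ℕ → Ω → ℝ} {σ : ℝ}

lemma eventually_exp_le_measureReal_mul_sqrt_le_sum (hi : iIndepFun Z P)
    (hd : ∀ n, IdentDistrib (Z n) (Z 0) P P) (h0 : ∫ ω, Z 0 ω ∂P = 0) (hσ : 0 < σ)
    (hv : variance (Z 0) P = σ ^ 2) {a : ℝ} (ha : 0 ≤ a) :
    ∀ᶠ b : ℕ in atTop, Real.exp (-(a + 3) ^ 2 / 2) ≤
      P.real {ω | a * σ * √b ≤ ∑ i ∈ Finset.range b, Z i ω} := by
  rw [variance_of_integral_eq_zero (hd 0).aemeasurable_fst h0] at hv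
  have hclt := tendstoInDistribution_inv_sqrt_mul_sum (P := P) (X := fun n ω => Z n ω / σ)
    (P' := gaussianReal 0 1) (Y := id) ⟨aemeasurable_id, Measure.map_id⟩
    (by simp [integral_div, h0]) (by simp [div_pow, integral_div, hv, hσ.ne'])
    (hi.comp (fun _ x => x / σ) fun _ => by fun_prop)
    (fun n => (hd n).comp (u := fun x => x / σ) (by fun_prop))
  have hlim := ProbabilityMeasure.le_liminf_measure_open_of_tendsto hclt.tendsto
    (isOpen_Ioi (a := a))
  simp only [ProbabilityMeasure.coe_mk, Measure.map_id] at hlim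
  have htail := (ENNReal.ofReal_lt_iff_lt_toReal (Real.exp_pos _).le (measure_ne_top _ _)).2
    (exp_lt_measureReal_gaussianReal_Ioi ha)
  filter_upwards [eventually_lt_of_lt_liminf (htail.trans_le hlim), eventually_gt_atTop 0]
    with b hb hb0
  have hsqrt : 0 < √(b : ℝ) := Real.sqrt_pos.2 (Nat.cast_pos.2 hb0)
  rw [Measure.map_apply_of_aemeasurable (hclt.forall_aemeasurable b) measurableSet_Ioi] at hb
  refine ((ENNReal.ofReal_le_iff_le_toReal (measure_ne_top _ _)).1 hb.le).trans
    (measureReal_mono fun ω hω => ?_)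
  simp only [Set.mem_preimage, Set.mem_Ioi, ← Finset.sum_div, Set.mem_ofPred_eq] at hω ⊢
  rw [← div_eq_inv_mul, div_div, lt_div_iff₀ (by positivity)] at hω
  linarith

end GaussianLowerBound

section ModerateDeviations

lemma exists_block_constants {s σ : ℝ} (hs : 0 < s) (hsσ : s < σ) :
    ∃ a > 0, ∃ c > 0, ∃ t < 1, 0 < t ∧ c * ((a + 3) ^ 2 / 2) < 1 ∧
      2 * s ^ 2 = c * t * (a * σ) ^ 2 := by
  have hσ : 0 < σ := hs.trans hsσ
  obtain ⟨t, hθt, ht1⟩ := exists_between ((div_lt_one (by positivity)).2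
    (pow_lt_pow_left₀ hsσ hs.le two_ne_zero) : s ^ 2 / σ ^ 2 < 1)
  have ht : 0 < t := lt_trans (by positivity) hθt
  have hlim : Tendsto (fun a : ℝ => s ^ 2 / σ ^ 2 / t * (1 + 3 * a⁻¹) ^ 2) atTop
      (nhds (s ^ 2 / σ ^ 2 / t * (1 + 3 * 0) ^ 2)) :=
    (((tendsto_inv_atTop_zero.const_mul 3).const_add 1).pow 2).const_mul _
  obtain ⟨a, hsmall, ha⟩ := ((hlim.eventually_lt_const
    (by simpa using (div_lt_one ht).2 hθt)).and (eventually_gt_atTop 0)).exists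
  refine ⟨a, ha, 2 * s ^ 2 / (t * (a * σ) ^ 2), by positivity, t, ht1, ht, ?_, by field_simp⟩
  calc 2 * s ^ 2 / (t * (a * σ) ^ 2) * ((a + 3) ^ 2 / 2)
      = s ^ 2 / σ ^ 2 / t * (1 + 3 * a⁻¹) ^ 2 := by field_simp
    _ < 1 := hsmall

lemma mul_sqrt_le_of_blocks {s r c t y : ℝ} {b k m : ℕ} (hs : 0 ≤ s) (hr : 0 ≤ r)
    (ht : 0 ≤ t) (hy : 0 ≤ y) (hsr : 2 * s ^ 2 = c * t * r ^ 2) (hk : c * y ≤ k)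
    (hm : t * m ≤ k * b) :
    s * √(2 * m * y) ≤ k * (r * √b) := by
  rw [← sq_le_sq₀ (by positivity) (by positivity), mul_pow, mul_pow, mul_pow,
    Real.sq_sqrt (by positivity), Real.sq_sqrt (by positivity)]
  calc s ^ 2 * (2 * m * y) = (c * y) * r ^ 2 * (t * m) := by linear_combination m * y * hsr
    _ ≤ k * r ^ 2 * (k * b) := by gcongr
    _ = k ^ 2 * (r ^ 2 * b) := by ring

lemma mul_le_mul_div_of_le {t : ℝ} {k m : ℕ} (hk : 0 < k) (hkm : k ≤ (1 - t) * m) :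
    t * m ≤ k * (m / k : ℕ) := by
  have hlt : (m : ℝ) < k * (m / k : ℕ) + k := by
    exact_mod_cast Nat.lt_mul_div_succ m hk
  linarith

variable {Ω : Type*} [MeasurableSpace Ω] {P : Measure Ω} [IsProbabilityMeasure P]
  {Z : ℕ → Ω → ℝ} {σ : ℝ}

lemma eventually_natCast_ceil_mul_le_mul {ι : Type*} {f : Filter ι} {y x : ι → ℝ} {c ε : ℝ}
    (hc : 0 < c) (hy : Tendsto y f atTop) (hyx : y =o[f] x) (hx : ∀ j, 0 ≤ x j) (hε : 0 < ε) :
    ∀ᶠ j in f, (⌈c * y j⌉₊ : ℝ) ≤ ε * x j := by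
  filter_upwards [hyx.bound (div_pos hε (add_pos hc one_pos)), hy.eventually_ge_atTop 1]
    with j hj hj1
  rw [Real.norm_of_nonneg (zero_le_one.trans hj1), Real.norm_of_nonneg (hx j),
    div_mul_eq_mul_div, le_div_iff₀ (by positivity)] at hj
  have := Nat.ceil_lt_add_one (show 0 ≤ c * y j by positivity)
  linarith

/- Cut `m` into `k ∼ c y` blocks of length `b`; by the central limit theorem each block sum
exceeds `a σ √b` with probability at least `exp (-(a + 3) ^ 2 / 2)`, and `c` and `a` are such that
`k` of these events together produce the level `s √(2 m y)` at a cost below `exp (-y)`. -/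
lemma exists_exp_le_measureReal_mul_sqrt_le_sum (hm : ∀ n, Measurable (Z n)) (hi : iIndepFun Z P)
    (hd : ∀ n, IdentDistrib (Z n) (Z 0) P P) (h0 : ∫ ω, Z 0 ω ∂P = 0)
    (hv : variance (Z 0) P = σ ^ 2) {s : ℝ} (hs : 0 < s) (hsσ : s < σ) {ι : Type*} {f : Filter ι}
    {y : ι → ℝ} {m : ι → ℕ} (hy : Tendsto y f atTop) (hym : y =o[f] fun j => (m j : ℝ)) :
    ∃ m' ≤ m, ∃ β < 1, ∀ᶠ j in f, Real.exp (-(β * y j)) ≤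
      P.real {ω | s * √(2 * m j * y j) ≤ ∑ i ∈ Finset.range (m' j), Z i ω} := by
  have hσ : 0 < σ := hs.trans hsσ
  obtain ⟨a, ha, c, hc, t, ht1, ht, hca, hlevel⟩ := exists_block_constants hs hsσ
  obtain ⟨β, hcβ, hβ⟩ := exists_between hca
  obtain ⟨b₀, hb₀⟩ := eventually_atTop.1
    (eventually_exp_le_measureReal_mul_sqrt_le_sum hi hd h0 hσ hv ha.le)
  set k : ι → ℕ := fun j => ⌈c * y j⌉₊
  have hk : ∀ ε > 0, ∀ᶠ j in f, (k j : ℝ) ≤ ε * m j :=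
    fun _ hε => eventually_natCast_ceil_mul_le_mul hc hy hym (fun _ => Nat.cast_nonneg _) hε
  refine ⟨fun j => k j * (m j / k j), fun j => Nat.mul_div_le _ _, β, hβ, ?_⟩
  filter_upwards [hk (1 - t) (sub_pos.2 ht1), hk (1 / (b₀ + 1)) (by positivity),
    hy.eventually_gt_atTop 0,
    hy.eventually_ge_atTop ((a + 3) ^ 2 / 2 / (β - c * ((a + 3) ^ 2 / 2)))] with j hkt hkb hy0 hyβ
  have hk0 : 0 < k j := Nat.ceil_pos.2 (by positivity)
  have hb : b₀ ≤ m j / k j := by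
    rw [Nat.le_div_iff_mul_le hk0]
    rw [div_mul_eq_mul_div, one_mul, le_div_iff₀ (by positivity)] at hkb
    have : k j * (b₀ + 1) ≤ m j := by exact_mod_cast hkb
    linarith
  have hcost : k j * ((a + 3) ^ 2 / 2) ≤ β * y j := by
    rw [div_le_iff₀ (sub_pos.2 hcβ)] at hyβ
    have : (k j : ℝ) * ((a + 3) ^ 2 / 2) ≤ (c * y j + 1) * ((a + 3) ^ 2 / 2) := by
      gcongr
      exact (Nat.ceil_lt_add_one (by positivity)).le
    linarith
  calc Real.exp (-(β * y j)) ≤ Real.exp (-(a + 3) ^ 2 / 2) ^ k j := by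
        rw [← Real.exp_nat_mul, Real.exp_le_exp]
        linarith
    _ ≤ P.real {ω | a * σ * √(m j / k j : ℕ) ≤ ∑ i ∈ Finset.range (m j / k j), Z i ω} ^ k j := by
        gcongr
        exact hb₀ _ hb
    _ ≤ P.real {ω | k j * (a * σ * √(m j / k j : ℕ)) ≤
          ∑ i ∈ Finset.range (k j * (m j / k j)), Z i ω} :=
        measureReal_le_sum_pow_le hm hi hd _ _ _
    _ ≤ _ := measureReal_mono fun ω hω => (mul_sqrt_le_of_blocks hs.le (by positivity) ht.le
        hy0.le hlevel (Nat.le_ceil _) (mul_le_mul_div_of_le hk0 hkt)).trans hω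

end ModerateDeviations

section ExponentialMoments

variable {Ω : Type*} [MeasurableSpace Ω] {P : Measure Ω}

lemma integrableExpSet_neg (X : Ω → ℝ) :
    integrableExpSet (fun ω => -X ω) P = -integrableExpSet X P := by
  ext t
  simp [integrableExpSet]

lemma zero_mem_interior_integrableExpSet_neg {X : Ω → ℝ}
    (hX : 0 ∈ interior (integrableExpSet X P)) :
    0 ∈ interior (integrableExpSet (fun ω => -X ω) P) := by
  rw [integrableExpSet_neg, mem_interior_iff_mem_nhds]
  exact neg_mem_nhds_zero ℝ (mem_interior_iff_mem_nhds.1 hX)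

end ExponentialMoments

section LowerHalf

variable {Ω : Type*} [MeasurableSpace Ω] {P : Measure Ω} [IsProbabilityMeasure P]

lemma ae_frequently_le_of_not_summable_measureReal {T : ℕ → Ω → ℝ} (hT : ∀ j, Measurable (T j))
    (hi : iIndepFun T P) {x : ℕ → ℝ} (hsum : ¬ Summable fun j => P.real {ω | x j ≤ T j ω}) :
    ∀ᵐ ω ∂P, ∃ᶠ j in atTop, x j ≤ T j ω := by
  have hmeas : ∀ j, MeasurableSet {ω | x j ≤ T j ω} := fun j =>
    measurableSet_le measurable_const (hT j)
  have hone := measure_limsup_eq_one hmeas ((iIndepSet_iff_meas_biInter hmeas).2 fun s =>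
      hi.meas_biInter fun j _ => ⟨Set.Ici (x j), measurableSet_Ici, rfl⟩)
    (not_ne_iff.1 fun hne => hsum (ENNReal.summable_toReal hne))
  filter_upwards [(prob_compl_eq_zero_iff (MeasurableSet.measurableSet_limsup hmeas)).2 hone]
    with ω hω
  exact mem_limsup_iff_frequently_mem.1 hω

lemma natCast_pow_succ_sub_pow {K : ℕ} (hK : 0 < K) (j : ℕ) :
    ((K ^ (j + 1) - K ^ j : ℕ) : ℝ) = (1 - (K : ℝ)⁻¹) * K ^ (j + 1) := by
  have hK' : (K : ℝ) ≠ 0 := Nat.cast_ne_zero.2 hK.ne'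
  rw [Nat.cast_sub (Nat.pow_le_pow_right hK (Nat.le_add_right j 1))]
  push_cast
  field_simp
  ring

variable {Z : ℕ → Ω → ℝ}

lemma exists_ae_frequently_mul_lilScale_le_sum_Ico {σ u : ℝ} (hm : ∀ n, Measurable (Z n))
    (hi : iIndepFun Z P) (hd : ∀ n, IdentDistrib (Z n) (Z 0) P P) (h0 : ∫ ω, Z 0 ω ∂P = 0)
    (hv : variance (Z 0) P = σ ^ 2) (hu : 0 < u) (huσ : u < σ) {K : ℕ} (hK : 1 < K) :
    ∃ b : ℕ → ℕ, (∀ j, K ^ j ≤ b j ∧ b j ≤ K ^ (j + 1)) ∧ ∀ᵐ ω ∂P, ∃ᶠ j in atTop,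
      u * (√(1 - (K : ℝ)⁻¹) * lilScale (K ^ (j + 1))) ≤
        ∑ i ∈ Finset.Ico (K ^ j) (b j), Z i ω := by
  have hK' : (1 : ℝ) < K := Nat.one_lt_cast.2 hK
  have hpow : Tendsto (fun j : ℕ => (K : ℝ) ^ (j + 1)) atTop atTop :=
    (tendsto_pow_atTop_atTop_of_one_lt hK').comp (tendsto_add_atTop_nat 1)
  have hKinv : 0 < 1 - (K : ℝ)⁻¹ := sub_pos.2 (inv_lt_one_of_one_lt₀ hK')
  have hlen := natCast_pow_succ_sub_pow (zero_lt_one.trans hK)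
  have hscale : ∀ j, √(2 * (K ^ (j + 1) - K ^ j : ℕ) * Real.log (Real.log (K ^ (j + 1)))) =
      √(1 - (K : ℝ)⁻¹) * lilScale (K ^ (j + 1)) := fun j => by
    rw [lilScale, ← Real.sqrt_mul hKinv.le, hlen]
    ring_nf
  obtain ⟨m', hm', β, hβ, hdev⟩ := exists_exp_le_measureReal_mul_sqrt_le_sum hm hi hd h0 hv hu huσ
    (f := atTop) (m := fun j => K ^ (j + 1) - K ^ j) (tendsto_log_log_atTop.comp hpow)
    (by simpa only [hlen] using!
      (isLittleO_log_log_id.comp_tendsto hpow).const_mul_right hKinv.ne')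
  have hle : ∀ j, K ^ j ≤ K ^ (j + 1) := fun j => Nat.pow_le_pow_right hK.le j.le_succ
  have hb : ∀ j, K ^ j + m' j ≤ K ^ (j + 1) := fun j => by
    rw [← Nat.le_sub_iff_add_le' (hle j)]
    exact hm' j
  refine ⟨fun j => K ^ j + m' j, fun j => ⟨Nat.le_add_right _ _, hb j⟩,
    ae_frequently_le_of_not_summable_measureReal
      (fun j => Finset.measurable_fun_sum _ fun i _ => hm i)
      (iIndepFun_sum_Ico hm hi (monotone_nat_of_le_succ hle) hb) fun hsum => ?_⟩
  refine hβ.not_gt ((summable_exp_neg_mul_log_log_pow_iff hK').1 ((summable_nat_add_iff 1).1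
    (hsum.of_norm_bounded_eventually_nat ?_)))
  filter_upwards [hdev] with j hj
  rw [Real.norm_of_nonneg (Real.exp_pos _).le]
  refine hj.trans_eq ?_
  simp only [Function.comp_apply, hscale]
  exact congrArg ENNReal.toReal
    ((identDistrib_sum_Ico hi hd (K ^ j) (m' j)).measure_mem_eq measurableSet_Ici).symm

lemma exists_nat_lt_sqrt_sub_sqrt {s u : ℝ} (hsu : s < u) (σ : ℝ) :
    ∃ K : ℕ, 1 < K ∧ s < u * √(1 - (K : ℝ)⁻¹) - σ * √((K : ℝ)⁻¹) := by
  have hinv : Tendsto (fun K : ℕ => (K : ℝ)⁻¹) atTop (nhds 0) := tendsto_inv_atTop_nhds_zero_nat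
  have hlim := ((hinv.const_sub 1).sqrt.const_mul u).sub (hinv.sqrt.const_mul σ)
  exact ((eventually_gt_atTop 1).and (hlim.eventually_const_lt (by simpa using hsu))).exists

lemma lilScale_pow_le {K : ℝ} (hK : 1 < K) {j : ℕ} (hj : j ≠ 0) :
    lilScale (K ^ j) ≤ √K⁻¹ * lilScale (K ^ (j + 1)) := by
  have hone : 1 < K ^ j := one_lt_pow₀ hK hj
  have hlog : 0 < Real.log (K ^ j) := Real.log_pos hone
  rw [lilScale, lilScale, ← Real.sqrt_mul (by positivity)]
  refine Real.sqrt_le_sqrt ?_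
  calc 2 * K ^ j * Real.log (Real.log (K ^ j)) ≤ 2 * K ^ j * Real.log (Real.log (K ^ (j + 1))) := by
        gcongr
        · exact hK.le
        · exact j.le_succ
    _ = K⁻¹ * (2 * K ^ (j + 1) * Real.log (Real.log (K ^ (j + 1)))) := by
        field_simp
        ring

theorem ae_eventually_neg_le_sum {s : ℝ} (hs : 0 < s) (hm : ∀ n, Measurable (Z n))
    (hi : iIndepFun Z P) (hd : ∀ n, IdentDistrib (Z n) (Z 0) P P)
    (hZ : 0 ∈ interior (integrableExpSet (Z 0) P)) (h0 : ∫ ω, Z 0 ω ∂P = 0)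
    (hvs : variance (Z 0) P < s ^ 2) :
    ∀ᵐ ω ∂P, ∀ᶠ n in atTop, -(s * phi n) ≤ ∑ i ∈ Finset.range n, Z i ω := by
  have hneg := ae_eventually_sum_le_mul_phi (P := P) (Z := fun n ω => -Z n ω) hs
    (fun n => (hm n).neg) (hi.comp (fun _ x => -x) fun _ => measurable_neg)
    (fun n => (hd n).comp measurable_neg) (zero_mem_interior_integrableExpSet_neg hZ)
    (by rw [integral_neg, h0, neg_zero]) (by rwa [variance_fun_neg])
  filter_upwards [hneg] with ω hω
  filter_upwards [hω] with n hn
  rw [Finset.sum_neg_distrib] at hn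
  exact neg_le.1 hn

/- The sum up to `K ^ j` is at least `-2 σ φ (K ^ j)`, which for large `K` is negligible compared
with the contribution of the block that starts at `K ^ j`. -/
theorem ae_frequently_mul_phi_le_sum {s : ℝ} (hs : 0 < s) (hm : ∀ n, Measurable (Z n))
    (hi : iIndepFun Z P) (hd : ∀ n, IdentDistrib (Z n) (Z 0) P P)
    (hZ : 0 ∈ interior (integrableExpSet (Z 0) P)) (h0 : ∫ ω, Z 0 ω ∂P = 0)
    (hsv : s ^ 2 < variance (Z 0) P) :
    ∀ᵐ ω ∂P, ∃ᶠ n in atTop, s * phi n ≤ ∑ i ∈ Finset.range n, Z i ω := by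
  obtain ⟨σ, hsσ, hv⟩ : ∃ σ, s < σ ∧ variance (Z 0) P = σ ^ 2 :=
    ⟨√(variance (Z 0) P), Real.lt_sqrt_of_sq_lt hsv, (Real.sq_sqrt (variance_nonneg _ _)).symm⟩
  have hσ : 0 < σ := hs.trans hsσ
  obtain ⟨u, hsu, huσ⟩ := exists_between hsσ
  obtain ⟨K, hK, hsK⟩ := exists_nat_lt_sqrt_sub_sqrt hsu (2 * σ)
  have hK' : (1 : ℝ) < K := Nat.one_lt_cast.2 hK
  obtain ⟨b, hb, hblock⟩ := exists_ae_frequently_mul_lilScale_le_sum_Ico hm hi hd h0 hv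
    (hs.trans hsu) huσ hK
  have hpow : Tendsto (fun j : ℕ => K ^ j) atTop atTop := tendsto_pow_atTop_atTop_of_one_lt hK
  filter_upwards [hblock, ae_eventually_neg_le_sum (s := 2 * σ) (by positivity) hm hi hd hZ h0
    (by rw [hv]; gcongr; linarith)] with ω hω hpast
  refine (tendsto_atTop_mono (fun j => (hb j).1) hpow).frequently ?_
  refine (hω.and_eventually ((hpow.eventually hpast).and (eventually_ne_atTop 0))).mono ?_
  rintro j ⟨hj, hpastj, hj0⟩
  have hb1 : 1 < b j := (one_lt_pow₀ hK hj0).trans_le (hb j).1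
  have hphi : phi (b j) ≤ lilScale (K ^ (j + 1)) := by
    rw [← lilScale_natCast]
    exact monotoneOn_lilScale (Set.mem_Ioi.2 (Nat.one_lt_cast.2 hb1))
      (Set.mem_Ioi.2 (one_lt_pow₀ hK' j.succ_ne_zero)) (by exact_mod_cast (hb j).2)
  have hphi' : phi (K ^ j) ≤ √(K : ℝ)⁻¹ * lilScale (K ^ (j + 1)) := by
    rw [← lilScale_natCast, Nat.cast_pow]
    exact lilScale_pow_le hK' hj0
  calc s * phi (b j) ≤ s * lilScale (K ^ (j + 1)) := by gcongr
    _ ≤ (u * √(1 - (K : ℝ)⁻¹) - 2 * σ * √((K : ℝ)⁻¹)) * lilScale (K ^ (j + 1)) :=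
        mul_le_mul_of_nonneg_right hsK.le (lilScale_nonneg _)
    _ ≤ -(2 * σ * phi (K ^ j)) + u * (√(1 - (K : ℝ)⁻¹) * lilScale (K ^ (j + 1))) := by
        linarith [mul_le_mul_of_nonneg_left hphi' (by positivity : 0 ≤ 2 * σ)]
    _ ≤ ∑ i ∈ Finset.range (b j), Z i ω := by
        rw [← Finset.sum_range_add_sum_Ico _ (hb j).1]
        exact add_le_add hpastj hj

lemma ae_frequently_mul_phi_le_sum_of_lt_sqrt {s : ℝ} (hm : ∀ n, Measurable (Z n))
    (hi : iIndepFun Z P) (hd : ∀ n, IdentDistrib (Z n) (Z 0) P P)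
    (hZ : 0 ∈ interior (integrableExpSet (Z 0) P)) (h0 : ∫ ω, Z 0 ω ∂P = 0)
    (hsv : s < √(variance (Z 0) P)) :
    ∀ᵐ ω ∂P, ∃ᶠ n in atTop, s * phi n ≤ ∑ i ∈ Finset.range n, Z i ω := by
  rcases (variance_nonneg (Z 0) P).eq_or_lt with hv | hv
  · have hs : 0 < -s := by simpa only [← hv, Real.sqrt_zero, Left.neg_pos_iff] using hsv
    filter_upwards [ae_eventually_neg_le_sum hs hm hi hd hZ h0 (hv ▸ sq_pos_of_pos hs)] with ω hω
    simpa only [neg_mul, neg_neg] using hω.frequently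
  · obtain ⟨r, hr, hrv⟩ := exists_between (max_lt hsv (Real.sqrt_pos.2 hv))
    have hr0 : 0 < r := (le_max_right _ _).trans_lt hr
    filter_upwards [ae_frequently_mul_phi_le_sum hr0 hm hi hd hZ h0
      ((Real.lt_sqrt hr0.le).1 hrv)] with ω hω
    refine hω.mono fun n hn => (mul_le_mul_of_nonneg_right ?_ (Real.sqrt_nonneg _)).trans hn
    exact (le_max_left _ _).trans hr.le

end LowerHalf

section IteratedLogarithm

variable {Ω : Type*} [MeasurableSpace Ω] {P : Measure Ω} [IsProbabilityMeasure P] {Z : ℕ → Ω → ℝ}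

theorem ae_limsup_sum_div_phi (hm : ∀ n, Measurable (Z n)) (hi : iIndepFun Z P)
    (hd : ∀ n, IdentDistrib (Z n) (Z 0) P P) (hZ : 0 ∈ interior (integrableExpSet (Z 0) P))
    (h0 : ∫ ω, Z 0 ω ∂P = 0) :
    ∀ᵐ ω ∂P, limsup (fun n => (((∑ i ∈ Finset.range n, Z i ω) / phi n : ℝ) : EReal)) atTop =
      (√(variance (Z 0) P) : ℝ) := by
  set σ := √(variance (Z 0) P)
  have hvar : variance (Z 0) P = σ ^ 2 := (Real.sq_sqrt (variance_nonneg _ _)).symm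
  have hphi : ∀ᶠ n : ℕ in atTop, 0 < phi n :=
    tendsto_natCast_atTop_atTop.eventually (tendsto_lilScale_atTop.eventually_gt_atTop 0)
  have hupper : ∀ᵐ ω ∂P, ∀ q : ℚ, σ < q → ∀ᶠ n in atTop, ∑ i ∈ Finset.range n, Z i ω ≤ q * phi n :=
    ae_all_iff.2 fun q => ae_all_iff.2 fun hq =>
      have hq0 : (0 : ℝ) < q := (Real.sqrt_nonneg _).trans_lt hq
      ae_eventually_sum_le_mul_phi hq0 hm hi hd hZ h0 (by rw [hvar]; gcongr)
  have hlower : ∀ᵐ ω ∂P, ∀ q : ℚ, (q : ℝ) < σ →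
      ∃ᶠ n in atTop, q * phi n ≤ ∑ i ∈ Finset.range n, Z i ω :=
    ae_all_iff.2 fun q => ae_all_iff.2 fun hq =>
      ae_frequently_mul_phi_le_sum_of_lt_sqrt hm hi hd hZ h0 hq
  filter_upwards [hupper, hlower] with ω hω₁ hω₂
  refine limsup_coe_eq_coe_iff.2 ⟨fun b hb => ?_, fun b hb => ?_⟩
  · obtain ⟨q, hσq, hqb⟩ := exists_rat_btwn hb
    filter_upwards [hω₁ q hσq, hphi] with n hn hn0
    exact ((div_le_iff₀ hn0).2 hn).trans hqb.le
  · obtain ⟨q, hbq, hqσ⟩ := exists_rat_btwn hb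
    refine ((hω₂ q hqσ).and_eventually hphi).mono fun n hn => ?_
    exact hbq.le.trans ((le_div_iff₀ hn.2).2 hn.1)

theorem ae_liminf_sum_div_phi (hm : ∀ n, Measurable (Z n)) (hi : iIndepFun Z P)
    (hd : ∀ n, IdentDistrib (Z n) (Z 0) P P) (hZ : 0 ∈ interior (integrableExpSet (Z 0) P))
    (h0 : ∫ ω, Z 0 ω ∂P = 0) :
    ∀ᵐ ω ∂P, liminf (fun n => (((∑ i ∈ Finset.range n, Z i ω) / phi n : ℝ) : EReal)) atTop =
      (-√(variance (Z 0) P) : ℝ) := by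
  have hneg := ae_limsup_sum_div_phi (P := P) (Z := fun n ω => -Z n ω) (fun n => (hm n).neg)
    (hi.comp (fun _ x => -x) fun _ => measurable_neg) (fun n => (hd n).comp measurable_neg)
    (zero_mem_interior_integrableExpSet_neg hZ) (by rw [integral_neg, h0, neg_zero])
  filter_upwards [hneg] with ω hω
  simp only [Finset.sum_neg_distrib, neg_div, variance_fun_neg] at hω
  rw [liminf_coe_eq_neg_limsup_coe_neg, hω, EReal.coe_neg]

end IteratedLogarithm

namespace Policy

variable {N τ : ℕ} {E : Type*} [MeasurableSpace E]

section Pathwise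

variable (π : Policy N τ E) (e : E) (x : ℕ → Fin N → Bool)

@[simp]
lemma length_history (n : ℕ) : (π.history e x n).length = n := by
  induction n with
  | zero => rfl
  | succ n ih => simp [history, ih]

lemma drop_history (n m : ℕ) : (π.history e x (n + m)).drop m = π.history e x n := by
  induction m with
  | zero => rfl
  | succ m ih => rw [← Nat.add_assoc, history, List.drop_succ_cons, ih]

lemma frameStart_history {t m : ℕ} (hm : m < τ) :
    frameStart τ (π.history e x (t * τ + m)) = π.history e x (t * τ) := by
  rw [frameStart, length_history, Nat.mul_add_mod', Nat.mod_eq_of_lt hm, drop_history]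

/-- The clients to which a packet is delivered in the `m` slots from slot `n` on. -/
def delivered (n m : ℕ) : Finset (Fin N) :=
  Finset.univ.filter fun i => (some i, true) ∈ (π.history e x (n + m)).take m

lemma mem_undelivered_history {t m : ℕ} (hm : m < τ) (i : Fin N) :
    i ∈ undelivered τ (π.history e x (t * τ + m)) ↔ i ∉ π.delivered e x (t * τ) m := by
  simp [undelivered, delivered, Nat.mod_eq_of_lt hm]

lemma delivered_zero (n : ℕ) : π.delivered e x n 0 = ∅ := by simp [delivered]

lemma delivered_succ_of_none {n m : ℕ} (h : π.act (π.history e x (n + m)) e = none) :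
    π.delivered e x n (m + 1) = π.delivered e x n m := by
  ext i
  simp [delivered, history, h]

lemma delivered_succ_of_some {n m : ℕ} {i : Fin N}
    (h : π.act (π.history e x (n + m)) e = some i) :
    π.delivered e x n (m + 1) =
      if x (n + m) i then insert i (π.delivered e x n m) else π.delivered e x n m := by
  ext j
  cases hx : x (n + m) i <;> simp [delivered, history, h, hx]

lemma notMem_delivered_of_act_eq_some {t m : ℕ} {i : Fin N} (hm : m < τ)
    (h : π.act (π.history e x (t * τ + m)) e = some i) : i ∉ π.delivered e x (t * τ) m :=
  (π.mem_undelivered_history e x hm i).1 (π.act_undelivered _ _ _ h)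

lemma count_history {t m : ℕ} (hm : m ≤ τ) (j : Fin N) :
    (π.history e x (t * τ + m)).count (some j, true) =
      (π.history e x (t * τ)).count (some j, true) +
        if j ∈ π.delivered e x (t * τ) m then 1 else 0 := by
  induction m with
  | zero => simp [delivered_zero]
  | succ m ih =>
    rw [← Nat.add_assoc, history, List.count_cons, ih (by omega)]
    cases h : π.act (π.history e x (t * τ + m)) e with
    | none => simp [π.delivered_succ_of_none e x h]
    | some i =>
      have hi := π.notMem_delivered_of_act_eq_some e x hm h
      rw [π.delivered_succ_of_some e x h]
      obtain rfl | hij := eq_or_ne j i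
      · cases hx : x (t * τ + m) j <;> simp [hi, hx]
      · cases hx : x (t * τ + m) i <;> simp [hx, hij, hij.symm]

lemma debt_history_succ (hτ : 0 < τ) (q : ℝ) (t : ℕ) (j : Fin N) :
    debt τ q (π.history e x ((t + 1) * τ)) j =
      debt τ q (π.history e x (t * τ)) j + q -
        if j ∈ π.delivered e x (t * τ) τ then 1 else 0 := by
  simp only [debt, length_history, Nat.mul_div_cancel _ hτ]
  rw [add_one_mul, π.count_history e x le_rfl]
  push_cast
  ring

lemma IsMWDF.nonIdling {π : Policy N τ E} {p q : ℝ} (hπ : π.IsMWDF p q) : π.NonIdling := by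
  obtain ⟨order, horder⟩ := hπ
  intro h e ⟨i, hi⟩ hn
  rw [(horder h e).2, List.find?_eq_none] at hn
  refine hn i ?_ (by simpa using hi)
  rw [List.mem_ofFn]
  exact (order (frameStart τ h) e).surjective i

lemma NonIdling.delivered_eq_univ {π : Policy N τ E} (hπ : π.NonIdling) {t m : ℕ}
    (hm : m < τ) (h : π.act (π.history e x (t * τ + m)) e = none) :
    π.delivered e x (t * τ) m = Finset.univ := by
  by_contra hne
  obtain ⟨i, hi⟩ : ∃ i, i ∉ π.delivered e x (t * τ) m := by
    simpa [Finset.eq_univ_iff_forall] using hne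
  exact hπ _ e ⟨i, (π.mem_undelivered_history e x hm i).2 hi⟩ h

variable [NeZero N]

/-- The outcome of the transmission in slot `n`. When the access point idles this is the state of
the channel of client `0`, so that every slot has an outcome and the outcomes are independent
Bernoulli variables. -/
def outcome (n : ℕ) : Bool := x n ((π.act (π.history e x n) e).getD 0)

/-- The number of successful outcomes in the `m` slots from slot `n` on. -/
def successes (n m : ℕ) : ℕ := ∑ l ∈ Finset.range m, (π.outcome e x (n + l)).toNat

lemma outcome_eq_of_act_eq_some {n : ℕ} {i : Fin N} (h : π.act (π.history e x n) e = some i) :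
    π.outcome e x n = x n i := by simp [outcome, h]

lemma successes_zero (n : ℕ) : π.successes e x n 0 = 0 := rfl

lemma successes_succ (n m : ℕ) :
    π.successes e x n (m + 1) = π.successes e x n m + (π.outcome e x (n + m)).toNat :=
  Finset.sum_range_succ _ _

lemma successes_succ' (n m : ℕ) :
    π.successes e x n (m + 1) = (π.outcome e x n).toNat + π.successes e x (n + 1) m := by
  rw [successes, Finset.sum_range_succ', add_comm, successes]
  simp [add_assoc, add_comm 1]

variable {π}

lemma NonIdling.card_delivered (hπ : π.NonIdling) {t m : ℕ} (hm : m ≤ τ) :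
    (π.delivered e x (t * τ) m).card = min N (π.successes e x (t * τ) m) := by
  induction m with
  | zero => simp [delivered_zero, successes_zero]
  | succ m ih =>
    have ih := ih (by omega)
    rw [successes_succ]
    cases h : π.act (π.history e x (t * τ + m)) e with
    | none =>
      rw [hπ.delivered_eq_univ e x hm h, Finset.card_univ, Fintype.card_fin] at ih
      rw [π.delivered_succ_of_none e x h, hπ.delivered_eq_univ e x hm h, Finset.card_univ,
        Fintype.card_fin]
      omega
    | some i =>
      have hi := π.notMem_delivered_of_act_eq_some e x hm h
      have hlt : (π.delivered e x (t * τ) m).card < N := by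
        simpa using Finset.card_lt_univ_of_notMem hi
      rw [π.delivered_succ_of_some e x h, π.outcome_eq_of_act_eq_some e x h]
      cases x (t * τ + m) i
      · simpa using ih
      · simp only [if_true, Finset.card_insert_of_notMem hi, Bool.toNat_true]
        omega

lemma NonIdling.sum_debt_history_succ (hπ : π.NonIdling) (hτ : 0 < τ) (q : ℝ) (t : ℕ) :
    ∑ j, debt τ q (π.history e x ((t + 1) * τ)) j =
      ∑ j, debt τ q (π.history e x (t * τ)) j +
        (N * q - min (N : ℝ) (π.successes e x (t * τ) τ)) := by
  have hcard : (∑ j, if j ∈ π.delivered e x (t * τ) τ then (1 : ℝ) else 0) =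
      min (N : ℝ) (π.successes e x (t * τ) τ) := by
    rw [Finset.sum_boole, Finset.filter_mem_eq_inter, Finset.univ_inter,
      hπ.card_delivered e x le_rfl, Nat.cast_min]
  simp only [π.debt_history_succ e x hτ, Finset.sum_sub_distrib, Finset.sum_add_distrib, hcard,
    Finset.sum_const, Finset.card_univ, Fintype.card_fin, nsmul_eq_mul]
  ring

lemma mem_delivered_iff_lt_successes {order : History N → E → Equiv.Perm (Fin N)}
    (horder : ∀ h e, π.act h e =
      (List.ofFn (order (frameStart τ h) e)).find? fun i => decide (i ∈ undelivered τ h))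
    {t m : ℕ} (hm : m ≤ τ) (k : Fin N) :
    order (π.history e x (t * τ)) e k ∈ π.delivered e x (t * τ) m ↔
      (k : ℕ) < π.successes e x (t * τ) m := by
  induction m generalizing k with
  | zero => simp [delivered_zero, successes_zero]
  | succ m ih =>
    have ih := fun k => ih (by omega) k
    have hact := horder (π.history e x (t * τ + m)) e
    rw [frameStart_history _ _ _ hm] at hact
    set ρ := order (π.history e x (t * τ)) e
    have hundel : ∀ k, ρ k ∈ undelivered τ (π.history e x (t * τ + m)) ↔
        π.successes e x (t * τ) m ≤ k := fun k => by
      rw [π.mem_undelivered_history e x hm, ih, not_lt]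
    rw [successes_succ]
    cases h : π.act (π.history e x (t * τ + m)) e with
    | none =>
      rw [h, eq_comm, List.find?_eq_none] at hact
      have hk := hact (ρ k) (List.mem_ofFn.2 ⟨k, rfl⟩)
      rw [decide_eq_true_eq, hundel, not_le] at hk
      rw [π.delivered_succ_of_none e x h, ih]
      omega
    | some i =>
      rw [h, eq_comm, List.find?_eq_some_iff_getElem] at hact
      obtain ⟨hi, r, hr, rfl, hbefore⟩ := hact
      rw [List.length_ofFn] at hr
      simp only [List.getElem_ofFn, decide_eq_true_eq, hundel] at hi
      have hr_eq : r = π.successes e x (t * τ) m := by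
        by_contra hne
        have hbefore := hbefore (π.successes e x (t * τ) m) (by omega)
        simp [List.getElem_ofFn, hundel] at hbefore
      rw [π.delivered_succ_of_some e x h, π.outcome_eq_of_act_eq_some e x h]
      simp only [List.getElem_ofFn]
      cases x (t * τ + m) (ρ ⟨r, hr⟩)
      · simpa using ih k
      · simp only [if_true, Finset.mem_insert, ih, ρ.injective.eq_iff, Bool.toNat_true, ← hr_eq,
          Fin.ext_iff]
        omega

end Pathwise

end Policy

section Binomial

lemma binomial_succ (m : ℕ) (p : unitInterval) :
    binomial (m + 1) p = unitInterval.toNNReal p • (binomial m p).map (fun s : ℕ => s + 1) +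
      unitInterval.toNNReal (unitInterval.symm p) • binomial m p := by
  refine Measure.ext_of_singleton fun k => ?_
  rw [← measureReal_eq_measureReal_iff, measureReal_add_apply, measureReal_nnreal_smul_apply,
    measureReal_nnreal_smul_apply,
    map_measureReal_apply (by fun_prop) (measurableSet_singleton k), binomial_real_singleton,
    binomial_real_singleton, unitInterval.coe_toNNReal, unitInterval.coe_toNNReal,
    unitInterval.coe_symm_eq]
  cases k with
  | zero =>
    have hpre : (· + 1) ⁻¹' {0} = (∅ : Set ℕ) := by ext; simp
    simp [hpre, pow_succ']
  | succ k =>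
    have hpre : (· + 1) ⁻¹' {k + 1} = ({k} : Set ℕ) := by ext; simp
    rw [hpre, binomial_real_singleton, Nat.choose_succ_succ, Nat.add_sub_add_right]
    obtain hk | hk := lt_or_ge k m
    · rw [show m - k = m - (k + 1) + 1 by omega]
      push_cast
      ring
    · rw [Nat.choose_eq_zero_of_lt (show m < k + 1 by omega)]
      push_cast
      ring

lemma integral_binomial_succ (m : ℕ) (p : unitInterval) (f : ℕ → ℝ) :
    ∫ s, f s ∂binomial (m + 1) p =
      p * ∫ s, f (s + 1) ∂binomial m p + (1 - p) * ∫ s, f s ∂binomial m p := by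
  have hmap : Integrable f ((binomial m p).map (· + 1)) :=
    (integrable_map_measure (by fun_prop) (by fun_prop)).2 (integrable_binomial _)
  rw [binomial_succ, integral_add_measure hmap.smul_measure_nnreal
    (integrable_binomial f).smul_measure_nnreal, integral_smul_nnreal_measure,
    integral_smul_nnreal_measure, integral_map (by fun_prop) (by fun_prop)]
  simp [NNReal.smul_def]

lemma measureReal_binomial_succ (m : ℕ) (p : unitInterval) (s : Set ℕ) :
    (binomial (m + 1) p).real s =
      p * (binomial m p).real ((· + 1) ⁻¹' s) + (1 - p) * (binomial m p).real s := by
  rw [binomial_succ, measureReal_add_apply, measureReal_nnreal_smul_apply,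
    measureReal_nnreal_smul_apply, map_measureReal_apply (by fun_prop) .of_discrete]
  simp

end Binomial

section Geometric

variable {p : unitInterval}

lemma integral_geometricMeasure_succ (hp : p ≠ 0) {f : ℕ → ℝ} {C : ℝ} (hf : ∀ k, |f k| ≤ C) :
    ∫ k, f k ∂geometricMeasure p =
      p * f 0 + (1 - p) * ∫ k, f (k + 1) ∂geometricMeasure p := by
  have hint : ∀ {g : ℕ → ℝ}, (∀ k, |g k| ≤ C) → Integrable g (geometricMeasure p) := fun hg =>
    .of_bound measurable_from_nat.aestronglyMeasurable C (.of_forall hg)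
  have hsum := hasSum_integral_geometricMeasure hp (hint hf)
  have hsum_succ := hasSum_integral_geometricMeasure hp (hint fun k => hf (k + 1))
  rw [← hasSum_nat_add_iff' 1] at hsum
  have heq := hsum.unique ((hsum_succ.mul_left (1 - (p : ℝ))).congr_fun fun k => by
    simp only [smul_eq_mul]; ring)
  simp only [Finset.range_one, Finset.sum_singleton, pow_zero, one_mul, smul_eq_mul] at heq
  linarith

section Truncation

lemma abs_min_natCast_le {m : ℕ} {y : ℝ} (hy : 0 ≤ y) : |min (m : ℝ) y| ≤ m := by
  rw [abs_of_nonneg (le_min (Nat.cast_nonneg m) hy)]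
  exact min_le_left _ _

variable {α : Type*} [MeasurableSpace α] (μ : Measure α) {y : α → ℝ}

lemma integrable_min_natCast [IsFiniteMeasure μ] (m : ℕ) (hm : Measurable y) (hy : ∀ a, 0 ≤ y a) :
    Integrable (fun a => min (m : ℝ) (y a)) μ :=
  .of_bound (measurable_const.min hm).aestronglyMeasurable m
    (.of_forall fun a => abs_min_natCast_le (hy a))

variable [IsProbabilityMeasure μ]

lemma abs_integral_min_natCast_le (m : ℕ) (hy : ∀ a, 0 ≤ y a) :
    |∫ a, min (m : ℝ) (y a) ∂μ| ≤ m := by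
  have h : ∀ᵐ a ∂μ, ‖min (m : ℝ) (y a)‖ ≤ m := .of_forall fun a => abs_min_natCast_le (hy a)
  simpa using norm_integral_le_of_norm_le_const h

lemma integral_min_natCast_succ_add_one (m : ℕ) (hm : Measurable y) (hy : ∀ a, 0 ≤ y a) :
    ∫ a, min ((m + 1 : ℕ) : ℝ) (1 + y a) ∂μ = 1 + ∫ a, min (m : ℝ) (y a) ∂μ := by
  have hmin : ∀ a, min ((m + 1 : ℕ) : ℝ) (1 + y a) = 1 + min (m : ℝ) (y a) := fun a => by
    rw [Nat.cast_succ, add_comm 1 (y a), min_add_add_right, add_comm]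
  simp only [hmin]
  rw [integral_add (integrable_const _) (integrable_min_natCast μ m hm hy)]
  simp

end Truncation

/-- The expectation of `min m (γ₁ + ⋯ + γ_N)`, for independent geometric variables `γ_i` on
`{1, 2, …}`. -/
noncomputable def busyTime (p : unitInterval) (N m : ℕ) : ℝ :=
  ∫ g : Fin N → ℕ, min (m : ℝ) (∑ i, ((g i : ℝ) + 1))
    ∂(Measure.pi fun _ : Fin N => geometricMeasure p)

lemma busyTime_zero_left (p : unitInterval) (m : ℕ) : busyTime p 0 m = 0 := by
  simp [busyTime]

lemma busyTime_zero_right (p : unitInterval) (N : ℕ) : busyTime p N 0 = 0 := by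
  have hmin : ∀ g : Fin N → ℕ, min (0 : ℝ) (∑ i, ((g i : ℝ) + 1)) = 0 := fun g =>
    min_eq_left (by positivity)
  simp [busyTime, hmin]

lemma busyTime_succ_left (N m : ℕ) :
    busyTime p (N + 1) m = ∫ k : ℕ, ∫ g : Fin N → ℕ,
      min (m : ℝ) (((k : ℝ) + 1) + ∑ i, ((g i : ℝ) + 1))
        ∂(Measure.pi fun _ : Fin N => geometricMeasure p) ∂geometricMeasure p := by
  rw [busyTime, ← ((measurePreserving_piFinSuccAbove
    (fun _ : Fin (N + 1) => geometricMeasure p) 0).symm).integral_comp', integral_prod]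
  · simp [MeasurableEquiv.piFinSuccAbove_symm_apply, Fin.sum_univ_succ, Fin.insertNthEquiv]
  · exact integrable_min_natCast _ m (by fun_prop) fun z => by positivity

lemma busyTime_succ_succ (hp : p ≠ 0) (N m : ℕ) :
    busyTime p (N + 1) (m + 1) =
      1 + p * busyTime p N m + (1 - p) * busyTime p (N + 1) m := by
  -- `H m c` is the busy time, at most `m`, of `N` clients after `c` slots
  let H (m : ℕ) (c : ℝ) : ℝ := ∫ g : Fin N → ℕ, min (m : ℝ) (c + ∑ i, ((g i : ℝ) + 1))
    ∂(Measure.pi fun _ : Fin N => geometricMeasure p)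
  have hbound : ∀ m (k : ℕ), |H m (k + 1)| ≤ m := fun m k =>
    abs_integral_min_natCast_le _ m fun g => by positivity
  have hsucc : ∀ c : ℝ, 0 ≤ c → H (m + 1) (c + 1) = 1 + H m c := fun c hc => by
    have hH := integral_min_natCast_succ_add_one (Measure.pi fun _ : Fin N => geometricMeasure p) m
      (y := fun g => c + ∑ i, ((g i : ℝ) + 1)) (by fun_prop) fun g => by positivity
    simpa only [H, add_comm c 1, add_assoc] using hH
  have hzero : H m 0 = busyTime p N m := by simp only [H, zero_add, busyTime]
  have hint : Integrable (fun k : ℕ => H m (k + 1)) (geometricMeasure p) :=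
    .of_bound measurable_from_nat.aestronglyMeasurable m (.of_forall (hbound m))
  have hshift : ∀ k : ℕ, H (m + 1) ((k + 1 : ℕ) + 1) = 1 + H m (k + 1) := fun k => by
    rw [hsucc _ (by positivity), Nat.cast_succ]
  rw [busyTime_succ_left, busyTime_succ_left, integral_geometricMeasure_succ hp (hbound (m + 1))]
  simp only [hshift]
  rw [integral_add (integrable_const _) hint, Nat.cast_zero, hsucc 0 le_rfl, hzero]
  simp only [integral_const, probReal_univ, smul_eq_mul, one_mul, H]
  ring

lemma integral_min_binomial (hp : p ≠ 0) (N m : ℕ) :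
    ∫ s, min (N : ℝ) s ∂binomial m p = p * busyTime p N m := by
  induction m generalizing N with
  | zero => simp [binomial_zero, busyTime_zero_right]
  | succ m ih =>
    cases N with
    | zero => simp [busyTime_zero_left]
    | succ N =>
      have hmin : ∀ s : ℕ, min ((N + 1 : ℕ) : ℝ) ((s + 1 : ℕ) : ℝ) = 1 + min (N : ℝ) s :=
        fun s => by
        rw [Nat.cast_succ, Nat.cast_succ, min_add_add_right, add_comm]
      rw [integral_binomial_succ, ih, busyTime_succ_succ hp]
      simp only [hmin]
      rw [integral_add (integrable_const _) (integrable_binomial _), ih]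
      simp only [integral_const, probReal_univ, smul_eq_mul, one_mul]
      ring

lemma mul_one_sub_idleFraction (N : ℕ) {τ : ℕ} (hτ : 0 < τ) :
    τ * (1 - idleFraction N τ p) = busyTime p N τ := by
  have hmax : ∀ g : Fin N → ℕ, max ((τ : ℝ) - ∑ i, ((g i : ℝ) + 1)) 0 =
      τ - min (τ : ℝ) (∑ i, ((g i : ℝ) + 1)) := fun g => by
    rw [← sub_self (τ : ℝ), max_sub_sub_left, min_comm]
  simp only [idleFraction, hmax]
  rw [integral_sub (integrable_const _)
    (integrable_min_natCast _ τ (by fun_prop) fun g => by positivity), ← busyTime]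
  simp only [integral_const, probReal_univ, smul_eq_mul, one_mul]
  field_simp
  ring

end Geometric

lemma indepFun_prodMk_of_indepFun {Ω α β γ : Type*} [MeasurableSpace Ω] [MeasurableSpace α]
    [MeasurableSpace β] [MeasurableSpace γ] {P : Measure Ω} [IsProbabilityMeasure P] {f : Ω → α}
    {g : Ω → β} {h : Ω → γ} (hf : Measurable f) (hg : Measurable g) (hh : Measurable h)
    (hfgh : IndepFun f (fun ω => (g ω, h ω)) P) (hgh : IndepFun g h P) :
    IndepFun (fun ω => (f ω, g ω)) h P := by
  have hfg : IndepFun f g P := hfgh.comp measurable_id measurable_fst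
  have : IsProbabilityMeasure (P.map f) := Measure.isProbabilityMeasure_map hf.aemeasurable
  have : IsProbabilityMeasure (P.map g) := Measure.isProbabilityMeasure_map hg.aemeasurable
  have : IsProbabilityMeasure (P.map h) := Measure.isProbabilityMeasure_map hh.aemeasurable
  rw [indepFun_iff_map_prod_eq_prod_map_map (by fun_prop) (by fun_prop)] at hfgh hgh hfg ⊢
  have hassoc := (measurePreserving_prodAssoc (P.map f) (P.map g) (P.map h)).symm
  rw [hfg, ← hassoc.map_eq, ← hgh, ← hfgh, Measure.map_map (by fun_prop) (by fun_prop)]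
  rfl

lemma sum_measureReal_inter_preimage_singleton {Ω ι : Type*} [MeasurableSpace Ω] [Fintype ι]
    [MeasurableSpace ι] [MeasurableSingletonClass ι] (P : Measure Ω) [IsFiniteMeasure P]
    {f : Ω → ι} (hf : Measurable f) (s : Set Ω) :
    ∑ i, P.real (s ∩ f ⁻¹' {i}) = P.real s := by
  have hsum := sum_measureReal_preimage_singleton (μ := P.restrict s) Finset.univ (f := f)
    fun i _ => hf (measurableSet_singleton i)
  simpa [measureReal_restrict_apply (hf (measurableSet_singleton _)), Set.inter_comm] using hsum

section Channel

variable {Ω E : Type*} [MeasurableSpace E] {N τ : ℕ}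

section SlotSigma

/-- The σ-algebra generated by the seed and the channel states before slot `n`. -/
abbrev slotSigma (U : Ω → E) (X : ℕ → Ω → Fin N → Bool) (n : ℕ) : MeasurableSpace Ω :=
  MeasurableSpace.comap (fun ω => (U ω, fun k : Finset.range n => X k ω)) inferInstance

variable (U : Ω → E) (X : ℕ → Ω → Fin N → Bool)

lemma measurable_slotSigma_seed (n : ℕ) : Measurable[slotSigma U X n] U :=
  measurable_fst.comp (comap_measurable _)

lemma measurable_slotSigma_channel {k n : ℕ} (hkn : k < n) : Measurable[slotSigma U X n] (X k) :=
  (measurable_pi_apply (⟨k, Finset.mem_range.2 hkn⟩ : Finset.range n)).comp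
    (measurable_snd.comp (comap_measurable fun ω => (U ω, fun k : Finset.range n => X k ω)))

lemma slotSigma_mono : Monotone (slotSigma U X) := fun _ n hmn =>
  ((measurable_slotSigma_seed U X n).prodMk (@measurable_pi_lambda _ _ _ (slotSigma U X n) _ _
    fun k => measurable_slotSigma_channel U X
      ((Finset.mem_range.1 k.2).trans_le hmn))).comap_le

end SlotSigma

section Adapted

local instance : MeasurableSpace (Option (Fin N)) := ⊤

local instance : MeasurableSpace (History N) := ⊤

namespace Policy

variable (π : Policy N τ E) (U : Ω → E) (X : ℕ → Ω → Fin N → Bool)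

lemma measurable_act : Measurable fun z : History N × E => π.act z.1 z.2 :=
  measurable_from_prod_countable_right fun h => measurable_to_countable' (π.measurableSet_act h)

lemma measurable_history (n : ℕ) :
    Measurable[slotSigma U X n] fun ω => π.history (U ω) (fun k => X k ω) n := by
  induction n with
  | zero => exact @measurable_const _ _ _ (slotSigma U X 0) _
  | succ n ih =>
    have hhist := ih.mono (slotSigma_mono U X n.le_succ) le_rfl
    have hact := π.measurable_act.comp (hhist.prodMk (measurable_slotSigma_seed U X (n + 1)))
    have hcons : Measurable fun z : (Option (Fin N) × (Fin N → Bool)) × History N =>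
        ((z.1.1, z.1.1.elim false z.1.2) :: z.2 : History N) := .of_discrete
    exact hcons.comp ((hact.prodMk (measurable_slotSigma_channel U X n.lt_succ_self)).prodMk hhist)

variable [NeZero N]

lemma measurable_target (n : ℕ) : Measurable[slotSigma U X n] fun ω =>
    (π.act (π.history (U ω) (fun k => X k ω) n) (U ω)).getD 0 :=
  (Measurable.of_discrete (f := fun a : Option (Fin N) => a.getD 0)).comp
    (π.measurable_act.comp
      ((π.measurable_history U X n).prodMk (measurable_slotSigma_seed U X n)))

lemma measurable_outcome {k n : ℕ} (hkn : k < n) :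
    Measurable[slotSigma U X n] fun ω => π.outcome (U ω) (fun k => X k ω) k :=
  (Measurable.of_discrete (f := fun z : (Fin N → Bool) × Fin N => z.1 z.2)).comp
    ((measurable_slotSigma_channel U X hkn).prodMk
      ((π.measurable_target U X k).mono (slotSigma_mono U X hkn.le) le_rfl))

lemma measurable_successes (n m : ℕ) :
    Measurable[slotSigma U X (n + m)] fun ω => π.successes (U ω) (fun k => X k ω) n m :=
  Finset.measurable_fun_sum (m := slotSigma U X (n + m)) _ fun l hl =>
    (Measurable.of_discrete (f := Bool.toNat)).comp
      (π.measurable_outcome U X (by have := Finset.mem_range.1 hl; omega))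

end Policy

end Adapted

variable [MeasurableSpace Ω]

/-- The random seed `U` and the channel states `X` of the model: the states of different slots are
independent of each other and of the seed, and each transmission succeeds with probability `p`. -/
structure IsChannel (P : Measure Ω) (U : Ω → E) (X : ℕ → Ω → Fin N → Bool) (p : unitInterval) :
    Prop where
  measurable_seed : Measurable U
  measurable_channel : ∀ n, Measurable (X n)
  iIndepFun_channel : iIndepFun X P
  measure_channel : ∀ n i, P {ω | X n ω i = true} = ENNReal.ofReal p
  indepFun_seed : IndepFun U (fun ω n => X n ω) P

namespace IsChannel

variable {P : Measure Ω} {U : Ω → E} {X : ℕ → Ω → Fin N → Bool}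
  {p : unitInterval}

lemma slotSigma_le (h : IsChannel P U X p) (n : ℕ) : slotSigma U X n ≤ ‹MeasurableSpace Ω› :=
  (h.measurable_seed.prodMk (measurable_pi_lambda _ fun k : Finset.range n =>
    h.measurable_channel k)).comap_le

variable [IsProbabilityMeasure P]

lemma indep_slotSigma_channel (h : IsChannel P U X p) (n : ℕ) :
    Indep (slotSigma U X n) (MeasurableSpace.comap (X n) inferInstance) P := by
  have hpast : Measurable fun ω (k : Finset.range n) => X k ω :=
    measurable_pi_lambda _ fun k => h.measurable_channel k
  have hseed : IndepFun U (fun ω => ((fun k : Finset.range n => X k ω), X n ω)) P :=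
    h.indepFun_seed.comp (φ := id)
      (ψ := fun x : ℕ → Fin N → Bool => ((fun k : Finset.range n => x k), x n))
      measurable_id (by fun_prop)
  have hindep := h.iIndepFun_channel.indepFun_finset (Finset.range n) {n} (by simp)
    h.measurable_channel
  exact indepFun_prodMk_of_indepFun h.measurable_seed hpast (h.measurable_channel n) hseed
    (hindep.comp (φ := id)
      (ψ := fun x : ({n} : Finset ℕ) → Fin N → Bool => x ⟨n, Finset.mem_singleton_self n⟩)
      measurable_id (measurable_pi_apply _))

variable [NeZero N] (π : Policy N τ E)

lemma measureReal_inter_outcome (h : IsChannel P U X p) (n : ℕ) {A : Set Ω}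
    (hA : MeasurableSet[slotSigma U X n] A) :
    P.real (A ∩ {ω | π.outcome (U ω) (fun k => X k ω) n = true}) = p * P.real A := by
  let target (ω : Ω) : Fin N := (π.act (π.history (U ω) (fun k => X k ω) n) (U ω)).getD 0
  have htarget : Measurable target := (π.measurable_target U X n).mono (h.slotSigma_le n) le_rfl
  have hindep : ∀ i, P.real (A ∩ target ⁻¹' {i} ∩ {ω | X n ω i = true}) =
      p * P.real (A ∩ target ⁻¹' {i}) := fun i => by
    have hAi := hA.inter (π.measurable_target U X n (measurableSet_singleton i))
    rw [measureReal_def, (Indep_iff _ _ _).1 (h.indep_slotSigma_channel n) (A ∩ target ⁻¹' {i})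
      {ω | X n ω i = true} hAi ⟨_, measurable_pi_apply i (measurableSet_singleton true), rfl⟩,
      ENNReal.toReal_mul, h.measure_channel, ENNReal.toReal_ofReal p.2.1, mul_comm,
      measureReal_def]
  have hsplit : ∀ i, A ∩ {ω | π.outcome (U ω) (fun k => X k ω) n = true} ∩ target ⁻¹' {i} =
      A ∩ target ⁻¹' {i} ∩ {ω | X n ω i = true} := fun i => by
    rw [Set.inter_right_comm]
    ext ω
    refine and_congr_right fun hω => ?_
    have htarget_eq : target ω = i := hω.2
    change X n ω (target ω) = true ↔ X n ω i = true
    rw [htarget_eq]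
  rw [← sum_measureReal_inter_preimage_singleton P htarget,
    ← sum_measureReal_inter_preimage_singleton P htarget A, Finset.mul_sum]
  exact Finset.sum_congr rfl fun i _ => by rw [hsplit, hindep]

lemma measureReal_inter_successes (h : IsChannel P U X p) (n m : ℕ) {A : Set Ω}
    (hA : MeasurableSet[slotSigma U X n] A) (s : Set ℕ) :
    P.real (A ∩ {ω | π.successes (U ω) (fun k => X k ω) n m ∈ s}) =
      P.real A * (binomial m p).real s := by
  induction m generalizing n A s with
  | zero =>
    by_cases hs : 0 ∈ s <;> simp [Policy.successes_zero, binomial_zero, measureReal_def, hs]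
  | succ m ih =>
    set O := {ω | π.outcome (U ω) (fun k => X k ω) n = true} with hO_def
    have hO : MeasurableSet[slotSigma U X (n + 1)] O :=
      π.measurable_outcome U X n.lt_succ_self (measurableSet_singleton true)
    have hA_succ := slotSigma_mono U X n.le_succ _ hA
    have hAO : P.real (A ∩ O) = p * P.real A := h.measureReal_inter_outcome π n hA
    have hAdiff : P.real (A \ O) = (1 - p) * P.real A := by
      have := measureReal_inter_add_sdiff (μ := P) (s := A) (h.slotSigma_le _ _ hO)
      linarith
    have hinter : A ∩ {ω | π.successes (U ω) (fun k => X k ω) n (m + 1) ∈ s} ∩ O =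
        A ∩ O ∩ {ω | π.successes (U ω) (fun k => X k ω) (n + 1) m ∈ (· + 1) ⁻¹' s} := by
      ext ω
      by_cases hω : π.outcome (U ω) (fun k => X k ω) n = true <;>
        simp [hO_def, Policy.successes_succ', hω, add_comm 1]
    have hdiff : (A ∩ {ω | π.successes (U ω) (fun k => X k ω) n (m + 1) ∈ s}) \ O =
        (A \ O) ∩ {ω | π.successes (U ω) (fun k => X k ω) (n + 1) m ∈ s} := by
      ext ω
      by_cases hω : π.outcome (U ω) (fun k => X k ω) n = true <;>
        simp [hO_def, Policy.successes_succ', hω]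
    rw [← measureReal_inter_add_sdiff (h.slotSigma_le _ _ hO), hinter, hdiff,
      ih (n + 1) (hA_succ.inter hO), ih (n + 1) (hA_succ.diff hO), hAO, hAdiff,
      measureReal_binomial_succ]
    ring

lemma indep_slotSigma_successes (h : IsChannel P U X p) (n m : ℕ) :
    Indep (slotSigma U X n) (MeasurableSpace.comap
      (fun ω => π.successes (U ω) (fun k => X k ω) n m) inferInstance) P := by
  rw [Indep_iff]
  rintro A _ hA ⟨s, -, rfl⟩
  have huniv := h.measureReal_inter_successes π n m (A := Set.univ) MeasurableSet.univ s
  have hinter := h.measureReal_inter_successes π n m hA s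
  rw [Set.univ_inter, probReal_univ, one_mul] at huniv
  rw [← ENNReal.toReal_eq_toReal_iff' (by finiteness) (by finiteness), ENNReal.toReal_mul]
  exact hinter.trans (congrArg _ huniv.symm)

lemma hasLaw_successes (h : IsChannel P U X p) (n m : ℕ) :
    HasLaw (fun ω => π.successes (U ω) (fun k => X k ω) n m) (binomial m p) P := by
  have hm := (π.measurable_successes U X n m).mono (h.slotSigma_le _) le_rfl
  refine ⟨hm.aemeasurable, ?_⟩
  ext s hs
  have huniv := h.measureReal_inter_successes π n m (A := Set.univ) MeasurableSet.univ s
  rw [Set.univ_inter, probReal_univ, one_mul] at huniv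
  rwa [Measure.map_apply hm hs, ← measureReal_eq_measureReal_iff]

lemma iIndepFun_successes (h : IsChannel P U X p) (m : ℕ) :
    iIndepFun (fun t ω => π.successes (U ω) (fun k => X k ω) (t * m) m) P :=
  iIndepFun_of_indep_of_measurable_succ (F := fun t => slotSigma U X (t * m))
    (fun _ _ hst => slotSigma_mono U X (Nat.mul_le_mul_right m hst))
    (fun t => by rw [add_one_mul]; exact π.measurable_successes U X (t * m) m)
    fun t => (h.indep_slotSigma_successes π (t * m) m).symm

end IsChannel

end Channel

namespace Policy

section Collapse

variable {N τ : ℕ} {E : Type*} [MeasurableSpace E] {π : Policy N τ E} [NeZero N]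

lemma IsMWDF.debt_le_debt_of_mem_delivered {p q : ℝ} (hπ : π.IsMWDF p q) (hp : 0 < p) (hτ : 0 < τ)
    (e : E) (x : ℕ → Fin N → Bool) (t : ℕ) {i j : Fin N}
    (hi : i ∈ π.delivered e x (t * τ) τ) (hj : j ∉ π.delivered e x (t * τ) τ) :
    debt τ q (π.history e x (t * τ)) j ≤ debt τ q (π.history e x (t * τ)) i := by
  obtain ⟨order, horder⟩ := hπ
  have hfrom : frameStart τ (π.history e x (t * τ)) = π.history e x (t * τ) :=
    π.frameStart_history e x (t := t) hτ
  have hanti := (horder (π.history e x (t * τ)) e).1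
  rw [hfrom] at hanti
  obtain ⟨k, rfl⟩ := (order (π.history e x (t * τ)) e).surjective i
  obtain ⟨l, rfl⟩ := (order (π.history e x (t * τ)) e).surjective j
  rw [mem_delivered_iff_lt_successes e x (fun h e => (horder h e).2) le_rfl] at hi hj
  have hkl : k ≤ l := Fin.le_def.2 (by omega)
  exact (div_le_div_iff_of_pos_right hp).1 (hanti hkl)

/-- The debts of the delivered clients drop by one relative to the others, and none of them was
smaller than the debt of a client that is left out. -/
lemma IsMWDF.debt_sub_debt_le_one {p q : ℝ} (hπ : π.IsMWDF p q) (hp : 0 < p) (hτ : 0 < τ)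
    (e : E) (x : ℕ → Fin N → Bool) (t : ℕ) (i j : Fin N) :
    debt τ q (π.history e x (t * τ)) i - debt τ q (π.history e x (t * τ)) j ≤ 1 := by
  induction t with
  | zero => simp [debt, history]
  | succ t ih =>
    rw [π.debt_history_succ e x hτ, π.debt_history_succ e x hτ]
    by_cases hi : i ∈ π.delivered e x (t * τ) τ <;> by_cases hj : j ∈ π.delivered e x (t * τ) τ <;>
      simp only [hi, hj, if_true, if_false]
    · linarith
    · linarith
    · linarith [hπ.debt_le_debt_of_mem_delivered hp hτ e x t hj hi]
    · linarith

end Collapse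

end Policy

lemma abs_sub_sum_div_card_le {ι : Type*} [Fintype ι] [Nonempty ι] {d : ι → ℝ} {c : ℝ}
    (h : ∀ i j, d i - d j ≤ c) (j : ι) : |d j - (∑ i, d i) / Fintype.card ι| ≤ c := by
  have hcard : (0 : ℝ) < Fintype.card ι := by exact_mod_cast Fintype.card_pos
  have hupper : ∑ i, (d j - d i) ≤ ∑ _i : ι, c := Finset.sum_le_sum fun i _ => h j i
  have hlower : ∑ i, (d i - d j) ≤ ∑ _i : ι, c := Finset.sum_le_sum fun i _ => h i j
  simp only [Finset.sum_sub_distrib, Finset.sum_const, Finset.card_univ, nsmul_eq_mul]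
    at hupper hlower
  rw [abs_sub_le_iff, sub_le_comm, le_div_iff₀ hcard, sub_le_iff_le_add, div_le_iff₀ hcard]
  constructor <;> linarith

section Frames

/-- The increment of the scaled total debt in a frame with `s` successful transmissions, if no slot
is left idle while a packet is undelivered. -/
noncomputable def frameIncrement (N : ℕ) (p q : ℝ) (s : ℕ) : ℝ := (N * q - min (N : ℝ) s) / p

/-- The standard deviation `σ_{p,τ}` of the increments of the scaled total debt. -/
noncomputable def frameStd (N τ : ℕ) (p : unitInterval) (q : ℝ) : ℝ :=
  √(variance (frameIncrement N p q) (binomial τ p))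

lemma abs_frameIncrement_le (N : ℕ) (p q : ℝ) (s : ℕ) :
    |frameIncrement N p q s| ≤ (|N * q| + N) / |p| := by
  rw [frameIncrement, abs_div]
  gcongr
  exact (abs_sub _ _).trans (add_le_add_right (abs_min_natCast_le (Nat.cast_nonneg s)) _)

lemma integral_frameIncrement_binomial {N τ : ℕ} {p : unitInterval} (hp : 0 < p) (hτ : 0 < τ)
    {q : ℝ} (hq : N * (q / p) = τ * (1 - idleFraction N τ p)) :
    ∫ s, frameIncrement N p q s ∂binomial τ p = 0 := by
  have hp' : (0 : ℝ) < p := hp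
  simp only [frameIncrement]
  rw [integral_div, integral_sub (integrable_const _)
      (integrable_min_natCast _ N measurable_from_nat Nat.cast_nonneg),
    integral_min_binomial hp.ne', ← mul_one_sub_idleFraction N hτ, ← hq, integral_const,
    probReal_univ]
  field_simp
  simp

variable {Ω : Type*} {N τ : ℕ} {E : Type*} [MeasurableSpace E] {π : Policy N τ E}
  {U : Ω → E} {X : ℕ → Ω → Fin N → Bool}

namespace Policy

lemma sum_totalIncrement (p q : ℝ) (t : ℕ) (ω : Ω) :
    ∑ i ∈ Finset.range t, π.totalIncrement p q U X i ω = (∑ j, π.debtAt q U X j t ω) / p := by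
  simp only [totalIncrement]
  rw [Finset.sum_comm, Finset.sum_div]
  refine Finset.sum_congr rfl fun j _ => ?_
  rw [← Finset.sum_div, Finset.sum_range_sub fun t => π.debtAt q U X j t ω]
  simp [debtAt, debt, history]

variable [NeZero N]

lemma NonIdling.totalIncrement_eq (hπ : π.NonIdling) (hτ : 0 < τ) (p q : ℝ) :
    π.totalIncrement p q U X = fun t ω =>
      frameIncrement N p q (π.successes (U ω) (fun n => X n ω) (t * τ) τ) := by
  ext t ω
  simp only [totalIncrement, ← Finset.sum_div, Finset.sum_sub_distrib, debtAt,
    hπ.sum_debt_history_succ _ _ hτ, frameIncrement]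
  ring

lemma IsMWDF.abs_debtAt_sub_le_one {p q : ℝ} (hπ : π.IsMWDF p q) (hp : 0 < p) (hτ : 0 < τ)
    (j : Fin N) (t : ℕ) (ω : Ω) :
    |π.debtAt q U X j t ω - (∑ i, π.debtAt q U X i t ω) / N| ≤ 1 := by
  have := abs_sub_sum_div_card_le (hπ.debt_sub_debt_le_one hp hτ (U ω) (fun n => X n ω) t) j
  rwa [Fintype.card_fin] at this

lemma IsMWDF.tendsto_scaledDebt_sub {p q : ℝ} (hπ : π.IsMWDF p q) (hp : 0 < p) (hτ : 0 < τ)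
    (j : Fin N) (ω : Ω) :
    Tendsto (fun t => π.scaledDebt p q U X j t ω -
      (N : ℝ)⁻¹ * ((∑ i ∈ Finset.range t, π.totalIncrement p q U X i ω) / phi t))
      atTop (nhds 0) := by
  have hbound : ∀ t, |π.debtAt q U X j t ω / p - (∑ i, π.debtAt q U X i t ω) / N / p| ≤ 1 / p :=
    fun t => by
      rw [← sub_div, abs_div, abs_of_pos hp]
      gcongr
      exact hπ.abs_debtAt_sub_le_one hp hτ j t ω
  have hphi : Tendsto (fun t : ℕ => (phi t)⁻¹) atTop (nhds 0) :=
    (tendsto_lilScale_atTop.comp tendsto_natCast_atTop_atTop).inv_tendsto_atTop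
  refine (hphi.zero_mul_isBoundedUnder_le (isBoundedUnder_of ⟨1 / p, hbound⟩)).congr fun t => ?_
  rw [sum_totalIncrement, scaledDebt]
  ring

lemma IsMWDF.limsup_scaledDebt {p q : ℝ} (hπ : π.IsMWDF p q) (hp : 0 < p) (hτ : 0 < τ)
    (j : Fin N) (ω : Ω) :
    limsup (fun t => (π.scaledDebt p q U X j t ω : EReal)) atTop = ((N : ℝ)⁻¹ : ℝ) *
      limsup (fun t => (((∑ i ∈ Finset.range t, π.totalIncrement p q U X i ω) / phi t : ℝ) : EReal))
        atTop := by
  have h := limsup_coe_add_of_tendsto_zero (u := fun t =>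
    (N : ℝ)⁻¹ * ((∑ i ∈ Finset.range t, π.totalIncrement p q U X i ω) / phi t))
    (hπ.tendsto_scaledDebt_sub (U := U) (X := X) hp hτ j ω)
  simp only [add_sub_cancel, EReal.coe_mul] at h
  rw [h, EReal.limsup_const_mul_of_nonneg_of_ne_top (by positivity) (EReal.coe_ne_top _)]

lemma IsMWDF.liminf_scaledDebt {p q : ℝ} (hπ : π.IsMWDF p q) (hp : 0 < p) (hτ : 0 < τ)
    (j : Fin N) (ω : Ω) :
    liminf (fun t => (π.scaledDebt p q U X j t ω : EReal)) atTop = ((N : ℝ)⁻¹ : ℝ) *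
      liminf (fun t => (((∑ i ∈ Finset.range t, π.totalIncrement p q U X i ω) / phi t : ℝ) : EReal))
        atTop := by
  have h := liminf_coe_add_of_tendsto_zero (u := fun t =>
    (N : ℝ)⁻¹ * ((∑ i ∈ Finset.range t, π.totalIncrement p q U X i ω) / phi t))
    (hπ.tendsto_scaledDebt_sub (U := U) (X := X) hp hτ j ω)
  simp only [add_sub_cancel, EReal.coe_mul] at h
  rw [h, EReal.liminf_const_mul_of_nonneg_of_ne_top (by positivity) (EReal.coe_ne_top _)]

end Policy

end Frames

section Main

variable {Ω : Type*} [MeasurableSpace Ω] {P : Measure Ω}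
  {N τ : ℕ} {E : Type*} [MeasurableSpace E] [NeZero N] {π : Policy N τ E}
  {U : Ω → E} {X : ℕ → Ω → Fin N → Bool} {p : unitInterval}

namespace Policy

lemma NonIdling.measurable_totalIncrement (hπ : π.NonIdling) (hC : IsChannel P U X p)
    (hτ : 0 < τ) (q : ℝ) (t : ℕ) : Measurable (π.totalIncrement p q U X t) := by
  rw [hπ.totalIncrement_eq hτ]
  exact (measurable_from_nat (f := frameIncrement N p q)).comp
    ((π.measurable_successes U X (t * τ) τ).mono (hC.slotSigma_le _) le_rfl)

variable [IsProbabilityMeasure P]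

lemma NonIdling.identDistrib_totalIncrement (hπ : π.NonIdling) (hC : IsChannel P U X p)
    (hτ : 0 < τ) (q : ℝ) (t : ℕ) :
    IdentDistrib (π.totalIncrement p q U X t) (frameIncrement N p q) P (binomial τ p) := by
  rw [hπ.totalIncrement_eq hτ]
  exact ((hC.hasLaw_successes π (t * τ) τ).identDistrib HasLaw.id).comp
    (measurable_from_nat (f := frameIncrement N p q))

lemma NonIdling.sqrt_variance_totalIncrement (hπ : π.NonIdling) (hC : IsChannel P U X p)
    (hτ : 0 < τ) (q : ℝ) (t : ℕ) :
    √(variance (π.totalIncrement p q U X t) P) = frameStd N τ p q := by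
  rw [(hπ.identDistrib_totalIncrement hC hτ q t).variance_eq, frameStd]

lemma NonIdling.iIndepFun_totalIncrement (hπ : π.NonIdling) (hC : IsChannel P U X p)
    (hτ : 0 < τ) (q : ℝ) : iIndepFun (π.totalIncrement p q U X) P := by
  rw [hπ.totalIncrement_eq hτ]
  exact (hC.iIndepFun_successes π τ).comp (fun _ => frameIncrement N p q)
    fun _ => measurable_from_nat

lemma NonIdling.integrableExpSet_totalIncrement (hπ : π.NonIdling) (hC : IsChannel P U X p)
    (hτ : 0 < τ) (q : ℝ) (t : ℕ) : integrableExpSet (π.totalIncrement p q U X t) P = Set.univ := by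
  refine Set.eq_univ_of_forall fun l => integrable_exp_mul_of_mem_Icc
    (a := -((|N * q| + N) / |(p : ℝ)|)) (b := (|N * q| + N) / |(p : ℝ)|)
    (hπ.measurable_totalIncrement hC hτ q t).aemeasurable (ae_of_all _ fun ω => ?_)
  rw [hπ.totalIncrement_eq hτ]
  exact abs_le.1 (abs_frameIncrement_le N p q _)

lemma NonIdling.ae_limsup_liminf_sum_totalIncrement (hπ : π.NonIdling) (hC : IsChannel P U X p)
    (hp : 0 < p) (hτ : 0 < τ) {q : ℝ} (hq : N * (q / p) = τ * (1 - idleFraction N τ p)) :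
    ∀ᵐ ω ∂P,
      limsup (fun t => (((∑ i ∈ Finset.range t, π.totalIncrement p q U X i ω) / phi t : ℝ) : EReal))
        atTop = (frameStd N τ p q : EReal) ∧
      liminf (fun t => (((∑ i ∈ Finset.range t, π.totalIncrement p q U X i ω) / phi t : ℝ) : EReal))
        atTop = (-frameStd N τ p q : ℝ) := by
  have hm := hπ.measurable_totalIncrement hC hτ q
  have hi := hπ.iIndepFun_totalIncrement hC hτ q
  have hlaw := hπ.identDistrib_totalIncrement hC hτ q
  have hd := fun t => (hlaw t).trans (hlaw 0).symm
  have hexp : 0 ∈ interior (integrableExpSet (π.totalIncrement p q U X 0) P) := by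
    simp [hπ.integrableExpSet_totalIncrement hC hτ q 0]
  have hmean : ∫ ω, π.totalIncrement p q U X 0 ω ∂P = 0 :=
    (hlaw 0).integral_eq.trans (integral_frameIncrement_binomial hp hτ hq)
  filter_upwards [ae_limsup_sum_div_phi hm hi hd hexp hmean,
    ae_liminf_sum_div_phi hm hi hd hexp hmean] with ω hsup hinf
  rw [hsup, hinf, hπ.sqrt_variance_totalIncrement hC hτ]
  exact ⟨rfl, rfl⟩

lemma IsMWDF.ae_limsup_scaledDebt {q : ℝ} (hπ : π.IsMWDF p q) (hC : IsChannel P U X p)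
    (hp : 0 < p) (hτ : 0 < τ) (hq : N * (q / p) = τ * (1 - idleFraction N τ p))
    (j : Fin N) :
    ∀ᵐ ω ∂P, limsup (fun t => (π.scaledDebt p q U X j t ω : EReal)) atTop =
      (frameStd N τ p q / N : ℝ) := by
  filter_upwards [hπ.nonIdling.ae_limsup_liminf_sum_totalIncrement hC hp hτ hq] with ω hω
  rw [hπ.limsup_scaledDebt hp hτ, hω.1, ← EReal.coe_mul, inv_mul_eq_div]

lemma IsMWDF.ae_liminf_scaledDebt {q : ℝ} (hπ : π.IsMWDF p q) (hC : IsChannel P U X p)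
    (hp : 0 < p) (hτ : 0 < τ) (hq : N * (q / p) = τ * (1 - idleFraction N τ p))
    (j : Fin N) :
    ∀ᵐ ω ∂P, liminf (fun t => (π.scaledDebt p q U X j t ω : EReal)) atTop =
      (-(frameStd N τ p q / N) : ℝ) := by
  filter_upwards [hπ.nonIdling.ae_limsup_liminf_sum_totalIncrement hC hp hτ hq] with ω hω
  rw [hπ.liminf_scaledDebt hp hτ, hω.2, ← EReal.coe_mul, inv_mul_eq_div, neg_div]

lemma IsMWDF.inClass {q : ℝ} (hπ : π.IsMWDF p q) (hC : IsChannel P U X p)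
    (hp : 0 < p) (hτ : 0 < τ) (hq : N * (q / p) = τ * (1 - idleFraction N τ p)) :
    π.InClass P p q U X (frameStd N τ p q) (fun _ => frameStd N τ p q / N)
      (fun _ => -(frameStd N τ p q / N)) where
  finite_limsup j := by
    filter_upwards [hπ.ae_limsup_scaledDebt hC hp hτ hq j, hπ.ae_liminf_scaledDebt hC hp hτ hq j]
      with ω hsup hinf
    rw [liminf_coe_eq_neg_limsup_coe_neg, EReal.coe_neg, neg_inj] at hinf
    rw [limsup_coe_abs, hsup, hinf, max_self]
    exact EReal.coe_lt_top _
  limsup_eq := hπ.ae_limsup_scaledDebt hC hp hτ hq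
  liminf_eq := hπ.ae_liminf_scaledDebt hC hp hτ hq
  sum_v := by
    rw [Finset.sum_const, Finset.card_fin, nsmul_eq_mul, mul_div_cancel₀ _ (NeZero.ne _)]
  sum_w := by
    rw [Finset.sum_const, Finset.card_fin, nsmul_eq_mul, mul_neg,
      mul_div_cancel₀ _ (NeZero.ne _)]

end Policy

end Main

namespace Policy

lemma exists_isMWDF (N τ : ℕ) (E : Type*) [MeasurableSpace E] {p : ℝ} (hp : 0 < p) (q : ℝ) :
    ∃ π : Policy N τ E, π.IsMWDF p q := by
  have hsort (d : Fin N → ℝ) : ∃ ρ : Equiv.Perm (Fin N), Antitone (d ∘ ρ) :=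
    ⟨Tuple.sort fun i => -d i, fun _ _ hij =>
      neg_le_neg_iff.1 (Tuple.monotone_sort (fun i => -d i) hij)⟩
  choose sorted hsorted using hsort
  refine ⟨⟨fun h _ => (List.ofFn (sorted (debt τ q (frameStart τ h)))).find?
    fun i => decide (i ∈ undelivered τ h), fun h a => MeasurableSet.const _, fun h _ i hi => ?_⟩,
    fun h _ => sorted (debt τ q h), fun h _ => ⟨fun i j hij => ?_, rfl⟩⟩
  · simpa using List.find?_some hi
  · exact div_le_div_of_nonneg_right (hsorted (debt τ q (frameStart τ h)) hij) hp.le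

lemma div_le_of_mem_costs {Ω E : Type*} [MeasurableSpace Ω] [MeasurableSpace E] {P : Measure Ω}
    {N τ : ℕ} [NeZero N] {U : Ω → E} {X : ℕ → Ω → Fin N → Bool} {p q σ c : ℝ}
    (hc : c ∈ costs (E := E) P N τ p q U X σ) : σ / N ≤ c := by
  obtain ⟨π, v, w, h, rfl⟩ := hc
  rw [div_le_iff₀ (Nat.cast_pos.2 (NeZero.pos N)), ← h.sum_v]
  calc ∑ j, v j ≤ ∑ _j : Fin N, ⨆ j, v j :=
        Finset.sum_le_sum fun j _ => le_ciSup (Set.finite_range v).bddAbove j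
    _ = (⨆ j, v j) * N := by simp [mul_comm]

end Policy

end RealTimeScheduling

theorem mainTheorem1 {Ω E : Type*} [MeasurableSpace Ω] [MeasurableSpace E]
    (P : MeasureTheory.Measure Ω) [MeasureTheory.IsProbabilityMeasure P]
    (N τ : ℕ) (hN : 0 < N) (hτ : 0 < τ) (p : unitInterval) (hp : 0 < p) (q : ℝ)
    -- channel states: `X n ω i` tells whether a transmission to client `i` in slot `n` succeeds
    (X : ℕ → Ω → Fin N → Bool) (hXm : ∀ n, Measurable (X n))
    (hXi : ProbabilityTheory.iIndepFun X P)
    (hXp : ∀ n i, P {ω | X n ω i = true} = ENNReal.ofReal p)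
    -- random seed of the policies, independent of the channel
    (U : Ω → E) (hUm : Measurable U)
    (hUX : ProbabilityTheory.IndepFun U (fun ω n => X n ω) P)
    -- heavy traffic
    (hq : N * (q / p) = τ * (1 - RealTimeScheduling.idleFraction N τ p)) :
    ∃ σ : ℝ,
      -- `σ` is the common standard deviation of the increments under non-idling policies
      (∀ π : RealTimeScheduling.Policy N τ E, π.NonIdling → ∀ t : ℕ,
        Real.sqrt (ProbabilityTheory.variance (π.totalIncrement p q U X t) P) = σ) ∧
      (∃ π : RealTimeScheduling.Policy N τ E, π.IsMWDF p q) ∧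
      ∀ π : RealTimeScheduling.Policy N τ E, π.IsMWDF p q →
        π.NonIdling ∧
        (∀ j, ∀ᵐ ω ∂P, Filter.limsup (fun t => ((π.scaledDebt p q U X j t ω : ℝ) : EReal))
          Filter.atTop = ((σ / N : ℝ) : EReal)) ∧
        ∃ v w : Fin N → ℝ, π.InClass P p q U X σ v w ∧ (⨆ j, v j) = σ / N ∧
          IsLeast (RealTimeScheduling.Policy.costs P N τ p q U X σ) (⨆ j, v j) := by
  have hC : RealTimeScheduling.IsChannel P U X p := ⟨hUm, hXm, hXi, hXp, hUX⟩
  have : NeZero N := ⟨hN.ne'⟩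
  refine ⟨RealTimeScheduling.frameStd N τ p q,
    fun π hπ t => hπ.sqrt_variance_totalIncrement hC hτ q t,
    RealTimeScheduling.Policy.exists_isMWDF N τ E hp q, fun π hπ => ?_⟩
  have hclass := hπ.inClass hC hp hτ hq
  refine ⟨hπ.nonIdling, hclass.limsup_eq, _, _, hclass, ciSup_const, ⟨π, _, _, hclass, rfl⟩,
    fun c hc => ?_⟩
  rw [ciSup_const]
  exact RealTimeScheduling.Policy.div_le_of_mem_costs hc
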